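/- Fix $\nu>0$ and $\xi=(\xi_1,\xi_2)\in\mathbb{R}^2\setminus\{0\}$. Let $A_\xi=\nu(\partial_z^2-|\xi|^2)$ be the operator in $L^2(\mathbb{R}_+;\mathbb{C}^2)$, $\mathbb{R}_+=(0,\infty)$, with domain $$D(A_\xi)=\{u\in H^2(\mathbb{R}_+;\mathbb{C}^2):\ -(\partial_z+|\xi|)u|_{z=0}+\xi|\xi|^{-1}\,\xi\cdot u|_{z=0}=0\},$$ and let $R(\lambda;A_\xi)=(\lambda-A_\xi)^{-1}$ for $\lambda\in\mathbb{C}\setminus((-\infty,-\nu|\xi|^2]\cup\{0\})$. For such $\lambda$ and $y\ge0$, there is exactly one continuous square integrable $G_{\lambda,\xi}(y,\cdot):[0,\infty)\to\mathbb{C}^{2\times2}$ with $$(R(\lambda;A_\xi)f)(y)=\int_0^\infty G_{\lambda,\xi}(y,z)f(z)\,dz\qquad\text{for all } f\in L^2(\mathbb{R}_+;\mathbb{C}^2);$$ this is the resolvent kernel. Let $\Gamma$ be a path in $\mathbb{C}\setminus(-\infty,0]$ (a continuous curve $\gamma:\mathbb{R}\to\mathbb{C}\setminus(-\infty,0]$,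 differentiable outside a countable set) with $\operatorname{Re}\gamma(s)\to-\infty$ as $s\to\pm\infty$, $\operatorname{Im}\gamma(s)<0$ for $s$ near $-\infty$, $\operatorname{Im}\gamma(s)>0$ for $s$ near $+\infty$, and $\int_\Gamma|e^{\lambda t}|\,|d\lambda|<\infty$ for every $t>0$. Define $$G_\xi(t,y;z)=\frac1{2\pi i}\int_\Gamma e^{\lambda t}G_{\lambda,\xi}(y,z)\,d\lambda .$$ Then for all $t>0$ and $y,z\ge0$ the integrals defining $G_\xi$ and $R_\xi$ converge absolutely and $$G_\xi(t,y;z)=H_\xi(t,y;z)+R_\xi(t,y;z),$$ where $$H_\xi(t,y;z)=\frac1{\sqrt{4\pi\nu t}}\left(e^{-\frac{|z-y|^2}{4\nu t}}+e^{-\frac{|z+y|^2}{4\nu t}}\right)e^{-\nu|\xi|^2t}I_2,$$ $$R_\xi(t,y;z)=\frac1{2\pi i}\int_\Gamma e^{\lambda t}\,\frac{\mu+|\xi|}{\mu\lambda|\xi|}\begin{pmatrix}\xi_2^2&-\xi_1\xi_2\\-\xi_1\xi_2&\xi_1^2\end{pmatrix}e^{-\mu(y+z)}\,d\lambda,\qquad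 \mu=\nu^{-1/2}\sqrt{\lambda+|\xi|^2\nu}$$ (principal square root). Moreover, for every $y>0$, $G_\xi(t,y;z)$ is differentiable in $t$ for $t,z>0$, is $C^2$ in $z\in[0,\infty)$ for each $t>0$, and solves $$\partial_tG_\xi(t,y;z)-\nu(\partial_z^2-|\xi|^2)G_\xi(t,y;z)=0\qquad(t>0,\ z>0),$$ $$-\nu(\partial_z+|\xi|)G_\xi(t,y;z)|_{z=0}+\nu\,\xi|\xi|^{-1}\,\xi\cdot G_\xi(t,y;z)|_{z=0}=0\qquad(t>0),$$ $$G_\xi(t,y;z)|_{t=0}=\delta_y(z)I_2,$$ the last in the sense that $\lim_{t\to0^+}\int_0^\infty G_\xi(t,y;z)f(z)\,dz=f(y)$ for every $f\in C_0^\infty(\mathbb{R}_+;\mathbb{C}^2)$. Here $\xi\cdot G_\xi$ is the row vector $\xi^{\mathsf T}G_\xi$. -/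

import Mathlib

open MeasureTheory Set Filter Topology
open scoped ContDiff Matrix

noncomputable section

/-- `u` belongs to the Sobolev space `H²(ℝ₊; ℂ²)`, `ℝ₊ = (0, ∞)`, with first and second derivatives
`u'`, `u''`: `u` and `u'` are the absolutely continuous representatives on `[0, ∞)`, and `u`, `u'`,
`u''` are square integrable. The traces of `u` and of `∂_z u` at the boundary are `u 0`, `u' 0`. -/
structure IsHalfLineH2 (u u' u'' : ℝ → Fin 2 → ℂ) : Prop where
  memLp : MemLp u 2 (volume.restrict (Ioi 0))
  memLp' : MemLp u' 2 (volume.restrict (Ioi 0))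
  memLp'' : MemLp u'' 2 (volume.restrict (Ioi 0))
  eq_integral : ∀ z : ℝ, 0 ≤ z → u z = u 0 + ∫ s in (0 : ℝ)..z, u' s
  eq_integral' : ∀ z : ℝ, 0 ≤ z → u' z = u' 0 + ∫ s in (0 : ℝ)..z, u'' s

/-- The boundary condition `-(u' + |ξ| u) + ξ |ξ|⁻¹ (ξ · u) = 0` for boundary values
`a` of `u` and `b` of `u'`. -/
def MixedBoundaryCondition (ξ : EuclideanSpace ℝ (Fin 2)) (a b : Fin 2 → ℂ) : Prop :=
  ∀ i, -(b i + (‖ξ‖ : ℂ) * a i) + (ξ i : ℂ) * (‖ξ‖ : ℂ)⁻¹ * ∑ k, (ξ k : ℂ) * a k = 0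

/-- `u ∈ D(A_ξ)` and `(lam - A_ξ) u = f`, where `A_ξ = ν (∂_z² - |ξ|²)` on `L²(ℝ₊; ℂ²)` and
`D(A_ξ)` consists of the `H²` functions that satisfy the mixed boundary condition. In other
words, `u = R(lam; A_ξ) f`. -/
def IsResolventSolution (ν : ℝ) (ξ : EuclideanSpace ℝ (Fin 2)) (lam : ℂ)
    (f u : ℝ → Fin 2 → ℂ) : Prop :=
  ∃ u' u'' : ℝ → Fin 2 → ℂ, IsHalfLineH2 u u' u'' ∧ MixedBoundaryCondition ξ (u 0) (u' 0) ∧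
    ∀ᵐ z ∂(volume.restrict (Ioi (0 : ℝ))),
      lam • u z - (ν : ℂ) • (u'' z - ((‖ξ‖ : ℂ) ^ 2) • u z) = f z

/-- `K` is the continuous representative on `[0, ∞)` of the resolvent applied to the point mass
`diag(δ_y, δ_y)`, where the resolvent acts on measures by duality:
`⟨R(lam; A_ξ) diag(δ_y, δ_y), f⟩ = ⟨diag(δ_y, δ_y), R(lam; A_ξ) f⟩` for all `f ∈ L²`. -/
structure IsResolventOfDelta (ν : ℝ) (ξ : EuclideanSpace ℝ (Fin 2)) (lam : ℂ) (y : ℝ)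
    (K : ℝ → Matrix (Fin 2) (Fin 2) ℂ) : Prop where
  continuousOn : ContinuousOn K (Ici 0)
  memLp : ∀ i j, MemLp (fun z => K z i j) 2 (volume.restrict (Ioi 0))
  duality : ∀ f u : ℝ → Fin 2 → ℂ, MemLp f 2 (volume.restrict (Ioi 0)) →
    IsResolventSolution ν ξ lam f u → u y = ∫ z in Ioi (0 : ℝ), K z *ᵥ f z

open Classical in
/-- The resolvent kernel `G_{lam, ξ}(y, z)`, for `y, z ≥ 0`. (It is unique for `z ≥ 0`; values at
`z < 0` are irrelevant.) -/
def resolventKernel (ν : ℝ) (ξ : EuclideanSpace ℝ (Fin 2)) (lam : ℂ) (y : ℝ) :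
    ℝ → Matrix (Fin 2) (Fin 2) ℂ :=
  if h : ∃ K, IsResolventOfDelta ν ξ lam y K then h.choose else 0

/-- Admissible integration paths `Γ`: continuous curves, differentiable outside a countable set,
that avoid `(-∞, 0]`, come from `Re = -∞` in the lower half plane and go to `Re = -∞` in the
upper half plane (so they pass around `0` on its right side), and along which `|e^{λ t}| |dλ|` has
finite total mass for each `t > 0`. -/
structure IsAdmissiblePath (γ : ℝ → ℂ) : Prop where
  continuous : Continuous γ
  differentiable : ∃ E : Set ℝ, E.Countable ∧ ∀ s, s ∉ E → DifferentiableAt ℝ γ s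
  mem_slitPlane : ∀ s, γ s ∈ Complex.slitPlane
  re_atBot : Tendsto (fun s => (γ s).re) atBot atBot
  re_atTop : Tendsto (fun s => (γ s).re) atTop atBot
  im_atBot : ∀ᶠ s in atBot, (γ s).im < 0
  im_atTop : ∀ᶠ s in atTop, 0 < (γ s).im
  integrable : ∀ t : ℝ, 0 < t →
    Integrable (fun s => Real.exp (t * (γ s).re) * ‖deriv γ s‖)

/-- `F` is absolutely integrable along `γ`. -/
def PathIntegrable (γ : ℝ → ℂ) (F : ℂ → ℂ) : Prop :=
  Integrable (fun s => F (γ s) * deriv γ s)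

/-- The normalized contour integral `(2πi)⁻¹ ∫_γ F(λ) dλ`. -/
def pathIntegral (γ : ℝ → ℂ) (F : ℂ → ℂ) : ℂ :=
  (2 * (Real.pi : ℂ) * Complex.I)⁻¹ * ∫ s : ℝ, F (γ s) * deriv γ s

/-- The integrand `e^{λ t} G_{λ, ξ}(y, z)`. -/
def greenIntegrand (ν : ℝ) (ξ : EuclideanSpace ℝ (Fin 2)) (t y z : ℝ) (lam : ℂ) :
    Matrix (Fin 2) (Fin 2) ℂ :=
  Complex.exp (lam * t) • resolventKernel ν ξ lam y z

/-- The time-dependent Green function `G_ξ(t, y; z)`. -/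
def greenKernel (ν : ℝ) (ξ : EuclideanSpace ℝ (Fin 2)) (γ : ℝ → ℂ) (t y z : ℝ) :
    Matrix (Fin 2) (Fin 2) ℂ :=
  Matrix.of fun i j => pathIntegral γ fun lam => greenIntegrand ν ξ t y z lam i j

/-- `μ = ν^{-1/2} √(λ + |ξ|² ν)`, with the principal square root. -/
def muRoot (ν : ℝ) (ξ : EuclideanSpace ℝ (Fin 2)) (lam : ℂ) : ℂ :=
  ((Real.sqrt ν)⁻¹ : ℂ) * Complex.sqrt (lam + (‖ξ‖ : ℂ) ^ 2 * (ν : ℂ))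

/-- The matrix `P_ξ`. -/
def perpMatrix (ξ : EuclideanSpace ℝ (Fin 2)) : Matrix (Fin 2) (Fin 2) ℂ :=
  !![(ξ 1 : ℂ) ^ 2, -((ξ 0 : ℂ) * (ξ 1 : ℂ)); -((ξ 0 : ℂ) * (ξ 1 : ℂ)), (ξ 0 : ℂ) ^ 2]

/-- The Neumann heat kernel on the half line times `e^{-ν |ξ|² t} I₂`. -/
def neumannHeatKernel (ν : ℝ) (ξ : EuclideanSpace ℝ (Fin 2)) (t y z : ℝ) :
    Matrix (Fin 2) (Fin 2) ℂ :=
  (((Real.sqrt (4 * Real.pi * ν * t))⁻¹ *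
      (Real.exp (-(z - y) ^ 2 / (4 * ν * t)) + Real.exp (-(z + y) ^ 2 / (4 * ν * t))) *
      Real.exp (-ν * ‖ξ‖ ^ 2 * t) : ℝ) : ℂ) • (1 : Matrix (Fin 2) (Fin 2) ℂ)

/-- The integrand `e^{λ t} (μ + |ξ|) / (μ λ |ξ|) P_ξ e^{-μ (y + z)}`. -/
def residualIntegrand (ν : ℝ) (ξ : EuclideanSpace ℝ (Fin 2)) (t y z : ℝ) (lam : ℂ) :
    Matrix (Fin 2) (Fin 2) ℂ :=
  (Complex.exp (lam * t) *
      ((muRoot ν ξ lam + (‖ξ‖ : ℂ)) / (muRoot ν ξ lam * lam * (‖ξ‖ : ℂ))) *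
      Complex.exp (-muRoot ν ξ lam * ((y + z : ℝ) : ℂ))) • perpMatrix ξ

/-- The residual kernel `R_ξ(t, y; z)`. -/
def residualKernel (ν : ℝ) (ξ : EuclideanSpace ℝ (Fin 2)) (γ : ℝ → ℂ) (t y z : ℝ) :
    Matrix (Fin 2) (Fin 2) ℂ :=
  Matrix.of fun i j => pathIntegral γ fun lam => residualIntegrand ν ξ t y z lam i j

end

/-! Write `a = |ξ|` and let `P` be `perpMatrix ξ`, that is `a² I - ξ ξᵀ`. Everything becomes
explicit in the variable `μ`, where `λ = ν (μ - a)(μ + a)`.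

The resolvent kernel is exhibited and then shown to be the only one. The boundary condition reads
`u'(0) + a⁻¹ P u(0) = 0`. The reflected Green function `(e^{-μ|y-z|} + e^{-μ(y+z)}) / (2νμ)`,
integrated against `(λ - A) u`, returns `u(y)` with the error `e^{-μy} u'(0) / μ`; the `P` term of
`resolventFormula` cancels exactly this error, by the boundary condition and `P² = a² P`
(`resolventFormula_duality`). Uniqueness (`IsResolventOfDelta.eqOn`) needs the resolvent equation to
be solvable for test functions, which is done by variation of constants. Hence the chosen
`resolventKernel` equals the formula on the half line.

In the contour integral, `dλ = 2νμ dμ` and `e^{λt} = e^{-νa²t} e^{νtμ²}` turn each term into a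
constant times `∫ e^{sw² - rw} k(w) dw`, with `s = νt` and either `k = 1` or `k(w) = 1/(w - a)`. The
exponential decays where `Re w² → -∞`, so the image of every admissible path can be replaced by a
vertical line to the right of `a` (`BoundedDerivOff.integral_curve`). For `k = 1` the line integral
is Gaussian and gives the heat kernel `h` (`dampedHeat`); for the other `k` it defines `R`
(`residualFactor`).

No closed form of `R` is needed. Polynomial division by `w - a` under the integral gives `∂_r R = -a
R - (2/a) h` and `∂_t R = (2ν + r/(at)) h`. From these, smoothness, the heat equation and the
boundary condition are algebra. For the initial value, the heat kernel centred at `y` yields `f(y)`,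
its mirror image at `-y` misses the support of `f`, and `R(t, r) = O(√t)` uniformly in `r ≥ y`, by a
line whose abscissa depends on `t` (`norm_residualFactor_le`). -/

noncomputable section

/-! ### Amplitudes with one singular point, and the exponential `e^{s w² - r w}` -/

/-- `k` is holomorphic off the point `a` with derivative `k'`, and both are bounded away
from `a`. -/
structure BoundedDerivOff (a : ℂ) (k k' : ℂ → ℂ) : Prop where
  hasDerivAt : ∀ w, w ≠ a → HasDerivAt k (k' w) w
  continuousOn : ContinuousOn k' {a}ᶜ
  bounded : ∀ δ > 0, ∃ C, 0 ≤ C ∧ ∀ w, δ ≤ ‖w - a‖ → ‖k w‖ ≤ C ∧ ‖k' w‖ ≤ C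

lemma boundedDerivOff_one (a : ℂ) : BoundedDerivOff a (fun _ => 1) (fun _ => 0) where
  hasDerivAt w _ := hasDerivAt_const w 1
  continuousOn := continuousOn_const
  bounded δ _ := ⟨1, zero_le_one, fun w _ => by simp⟩

lemma boundedDerivOff_inv (a : ℂ) :
    BoundedDerivOff a (fun w => (w - a)⁻¹) (fun w => -1 / (w - a) ^ 2) where
  hasDerivAt w hw := ((hasDerivAt_id w).sub_const a).fun_inv (sub_ne_zero.2 hw)
  continuousOn := by
    refine continuousOn_const.div (by fun_prop) fun w hw => pow_ne_zero 2 (sub_ne_zero.2 hw)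
  bounded δ hδ := by
    refine ⟨max δ⁻¹ (δ ^ 2)⁻¹, by positivity, fun w hw => ⟨?_, ?_⟩⟩
    · rw [norm_inv]
      exact (inv_anti₀ hδ hw).trans (le_max_left _ _)
    · rw [norm_div, norm_neg, norm_one, norm_pow, one_div]
      exact (inv_anti₀ (by positivity) (by gcongr)).trans (le_max_right _ _)

/-- The exponential `e^{s w² - r w}`. -/
def gaussExp (s r : ℝ) (w : ℂ) : ℂ := Complex.exp (s * w ^ 2 - r * w)

lemma norm_gaussExp (s r : ℝ) (w : ℂ) :
    ‖gaussExp s r w‖ = Real.exp (s * (w.re ^ 2 - w.im ^ 2) - r * w.re) := by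
  rw [gaussExp, Complex.norm_exp]
  congr 1
  simp [pow_two]

lemma continuous_gaussExp (s r : ℝ) : Continuous (gaussExp s r) := by
  unfold gaussExp; fun_prop

lemma hasDerivAt_gaussExp (s r : ℝ) (w : ℂ) :
    HasDerivAt (gaussExp s r) (gaussExp s r w * (2 * s * w - r)) w := by
  have h : HasDerivAt (fun w : ℂ => (s : ℂ) * w ^ 2 - r * w) (2 * s * w - r) w := by
    convert! ((hasDerivAt_pow 2 w).const_mul (s : ℂ)).sub ((hasDerivAt_id w).const_mul (r : ℂ))
      using 1
    simp; ring
  exact h.cexp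

/-- Common majorant for all differentiations under the integral sign below: differentiating in the
base point, in `r` or in `s` brings down a factor that is at most quadratic in `x`. -/
lemma integrable_one_add_sq_mul_exp {b : ℝ} (hb : 0 < b) (K : ℝ) :
    Integrable fun x : ℝ => K * ((1 + x ^ 2) * Real.exp (-b * x ^ 2)) := by
  have h := integrable_rpow_mul_exp_neg_mul_sq hb (show (-1 : ℝ) < 2 by norm_num)
  simp only [Real.rpow_ofNat] at h
  refine (((integrable_exp_neg_mul_sq hb).add h).const_mul K).congr (.of_forall fun x => ?_)
  simp only [Pi.add_apply]; ring

/-! ### Primitives along vertical rays -/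

/-- The antiderivative of `F` given by integration along the vertical ray in direction `σ I`. -/
def rayPrimitive (σ : ℝ) (F : ℂ → ℂ) (w : ℂ) : ℂ :=
  -((σ : ℂ) * Complex.I) * ∫ x in Ioi (0 : ℝ), F (w + σ * Complex.I * x)

/-- Half of the Gaussian decay pays for uniformity in `w`: `(Im w + σx)² ≥ x²/2 - (Im w)²`, whatever
the signs of `σ` and `Im w`. -/
lemma norm_gaussExp_ray_le {s r σ M : ℝ} (hs : 0 < s) (hσ : σ ^ 2 = 1) {w : ℂ} (hw : ‖w‖ ≤ M)
    (x : ℝ) : ‖gaussExp s r (w + σ * Complex.I * x)‖ ≤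
      Real.exp (2 * s * M ^ 2 + |r| * M) * Real.exp (-(s / 2) * x ^ 2) := by
  rw [norm_gaussExp, ← Real.exp_add]
  apply Real.exp_le_exp.2
  have h1 := (Complex.abs_re_le_norm w).trans hw
  have h2 := (Complex.abs_im_le_norm w).trans hw
  have hM : 0 ≤ M := (abs_nonneg _).trans h1
  have h3 : w.re ^ 2 ≤ M ^ 2 := by rw [← sq_abs]; gcongr
  have h4 : w.im ^ 2 ≤ M ^ 2 := by rw [← sq_abs]; gcongr
  have h5 : -(r * w.re) ≤ |r| * M :=
    (neg_le_abs _).trans (by rw [abs_mul]; gcongr)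
  simp only [Complex.add_re, Complex.mul_re, Complex.ofReal_re, Complex.I_re, Complex.ofReal_im,
    Complex.I_im, Complex.add_im, Complex.mul_im]
  have h6 : s * (x ^ 2 / 2 - w.im ^ 2) ≤ s * (w.im + σ * x) ^ 2 := by
    gcongr
    nlinarith [sq_nonneg (2 * w.im + σ * x), sq_nonneg x]
  have h7 : s * w.re ^ 2 ≤ s * M ^ 2 := by gcongr
  have h8 : s * w.im ^ 2 ≤ s * M ^ 2 := by gcongr
  ring_nf at *
  nlinarith

section Ray

variable {a : ℂ} {k k' : ℂ → ℂ} {s : ℝ}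

lemma continuousOn_comp_ray (hk : ContinuousOn k {a}ᶜ) (r σ : ℝ) {w : ℂ} {δ : ℝ} (hδ : 0 < δ)
    (h : ∀ x : ℝ, 0 ≤ x → δ ≤ ‖w + σ * Complex.I * x - a‖) :
    ContinuousOn (fun x : ℝ => gaussExp s r (w + σ * Complex.I * x) * k (w + σ * Complex.I * x))
      (Ici 0) := by
  have hc : Continuous fun x : ℝ => w + σ * Complex.I * x := by fun_prop
  refine (((continuous_gaussExp s r).comp hc).continuousOn).mul
    (hk.comp hc.continuousOn fun x hx => ?_)
  intro hxa
  have := h x hx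
  rw [mem_singleton_iff.1 hxa] at this
  simp at this; linarith

lemma BoundedDerivOff.continuousOn_self (hk : BoundedDerivOff a k k') : ContinuousOn k {a}ᶜ :=
  fun w hw => (hk.hasDerivAt w hw).continuousAt.continuousWithinAt

lemma BoundedDerivOff.integrableOn_ray (hk : BoundedDerivOff a k k') (hs : 0 < s) (r : ℝ)
    {σ : ℝ} (hσ : σ ^ 2 = 1) {w : ℂ} {δ : ℝ} (hδ : 0 < δ)
    (h : ∀ x : ℝ, 0 ≤ x → δ ≤ ‖w + σ * Complex.I * x - a‖) :
    IntegrableOn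
      (fun x : ℝ => gaussExp s r (w + σ * Complex.I * x) * k (w + σ * Complex.I * x)) (Ioi 0) := by
  obtain ⟨C, hC0, hC⟩ := hk.bounded δ hδ
  refine Integrable.mono' (g := fun x : ℝ => Real.exp (2 * s * ‖w‖ ^ 2 + |r| * ‖w‖) * C *
    Real.exp (-(s / 2) * x ^ 2)) ?_ ?_ ?_
  · exact ((integrable_exp_neg_mul_sq (by positivity)).const_mul _).integrableOn
  · exact ((continuousOn_comp_ray hk.continuousOn_self r σ hδ h).mono
      Ioi_subset_Ici_self).aestronglyMeasurable measurableSet_Ioi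
  · refine (ae_restrict_iff' measurableSet_Ioi).2 (.of_forall fun x hx => ?_)
    rw [norm_mul]
    calc _ ≤ _ := mul_le_mul (norm_gaussExp_ray_le hs hσ le_rfl x)
          (hC _ (h x (le_of_lt hx))).1 (norm_nonneg _) (by positivity)
      _ = _ := by ring

lemma hasDerivAt_gaussExp_mul (hk : BoundedDerivOff a k k') (r : ℝ) {w : ℂ} (hw : w ≠ a) :
    HasDerivAt (fun w => gaussExp s r w * k w)
      (gaussExp s r w * ((2 * s * w - r) * k w + k' w)) w := by
  convert! (hasDerivAt_gaussExp s r w).mul (hk.hasDerivAt w hw) using 1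
  ring

/-- Along the ray, the derivative in `w` is `(σI)⁻¹` times the derivative in `x`, so the
differentiated integral telescopes to the value at the starting point. A single `δ` for all nearby
rays is what bounds `k` and `k'` uniformly and permits differentiation under the integral. -/
lemma BoundedDerivOff.hasDerivAt_rayPrimitive (hk : BoundedDerivOff a k k') (hs : 0 < s) (r : ℝ)
    {σ : ℝ} (hσ : σ ^ 2 = 1) {w₀ : ℂ} {δ : ℝ} (hδ : 0 < δ)
    (h : ∀ᶠ w in 𝓝 w₀, ∀ x : ℝ, 0 ≤ x → δ ≤ ‖w + σ * Complex.I * x - a‖) :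
    HasDerivAt (rayPrimitive σ fun w => gaussExp s r w * k w) (gaussExp s r w₀ * k w₀) w₀ := by
  obtain ⟨C, hC0, hC⟩ := hk.bounded δ hδ
  have h0 := h.self_of_nhds
  have hne : ∀ {w : ℂ} {x : ℝ}, δ ≤ ‖w + σ * Complex.I * x - a‖ → w + σ * Complex.I * x ≠ a := by
    intro w x hx hxa
    rw [hxa] at hx
    simp at hx; linarith
  have habsσ : |σ| = 1 := by
    rw [← abs_one, ← sq_eq_sq_iff_abs_eq_abs, hσ, one_pow]
  set M := ‖w₀‖ + 1 with hM
  have hM0 : 0 ≤ M := by positivity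
  set F' : ℂ → ℂ := fun w => gaussExp s r w * ((2 * s * w - r) * k w + k' w) with hF'
  set K := Real.exp (2 * s * M ^ 2 + |r| * M) * ((2 * s * (M + 1) + |r| + 1) * C) with hK
  have hball : ∀ᶠ w in 𝓝 w₀, ‖w‖ < M :=
    continuous_norm.continuousAt.eventually (gt_mem_nhds (by simp [hM]))
  obtain ⟨hint, hder⟩ : IntegrableOn (fun x : ℝ => F' (w₀ + σ * Complex.I * x)) (Ioi 0) ∧
      HasDerivAt (fun w => ∫ x in Ioi (0 : ℝ), gaussExp s r (w + σ * Complex.I * x) *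
        k (w + σ * Complex.I * x)) (∫ x in Ioi (0 : ℝ), F' (w₀ + σ * Complex.I * x)) w₀ := by
    refine hasDerivAt_integral_of_dominated_loc_of_deriv_le
      (μ := volume.restrict (Ioi (0 : ℝ)))
      (F := fun w x => gaussExp s r (w + σ * Complex.I * x) * k (w + σ * Complex.I * x))
      (F' := fun w x => F' (w + σ * Complex.I * x)) (x₀ := w₀)
      (bound := fun x => K * ((1 + x ^ 2) * Real.exp (-(s / 2) * x ^ 2)))
      (h.and hball) (h.mono fun w hw =>
        ((continuousOn_comp_ray hk.continuousOn_self r σ hδ hw).mono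
        Ioi_subset_Ici_self).aestronglyMeasurable measurableSet_Ioi)
      (hk.integrableOn_ray hs r hσ hδ h0)
      (((continuousOn_comp_ray (s := s) (k := fun w => (2 * s * w - r) * k w + k' w)
          (((by fun_prop : Continuous fun w : ℂ => 2 * (s : ℂ) * w - r).continuousOn.mul
          hk.continuousOn_self).add hk.continuousOn) r σ hδ h0).mono
        Ioi_subset_Ici_self).aestronglyMeasurable measurableSet_Ioi)
      ?_ (integrable_one_add_sq_mul_exp (by positivity) K).integrableOn ?_
    · refine (ae_restrict_iff' measurableSet_Ioi).2 (.of_forall fun x hx w hw => ?_)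
      have hb := hC _ (hw.1 x (le_of_lt hx))
      have hx0 : (0 : ℝ) < x := hx
      have h1 : ‖2 * s * (w + σ * Complex.I * x) - r‖ ≤ 2 * s * (M + |x|) + |r| := by
        refine (norm_sub_le _ _).trans ?_
        rw [Complex.norm_real, Real.norm_eq_abs, norm_mul, norm_mul, Complex.norm_real,
          Real.norm_eq_abs, abs_of_pos hs, Complex.norm_ofNat]
        gcongr
        refine (norm_add_le _ _).trans ?_
        rw [norm_mul, norm_mul, Complex.norm_real, Complex.norm_real, Complex.norm_I,
          Real.norm_eq_abs, Real.norm_eq_abs, habsσ]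
        linarith [hw.2.le]
      have hxle : |x| ≤ 1 + x ^ 2 := by
        rw [abs_of_pos hx0]; nlinarith [sq_nonneg (x - 1)]
      calc ‖F' (w + σ * Complex.I * x)‖ ≤ (Real.exp (2 * s * M ^ 2 + |r| * M) *
            Real.exp (-(s / 2) * x ^ 2)) * ((2 * s * (M + |x|) + |r|) * C + C) := by
            rw [hF', norm_mul]
            refine mul_le_mul (norm_gaussExp_ray_le hs hσ hw.2.le x) ?_ (norm_nonneg _)
              (by positivity)
            refine (norm_add_le _ _).trans (add_le_add ?_ hb.2)
            rw [norm_mul]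
            exact mul_le_mul h1 hb.1 (norm_nonneg _) (by positivity)
        _ ≤ (Real.exp (2 * s * M ^ 2 + |r| * M) *
            Real.exp (-(s / 2) * x ^ 2)) * ((2 * s * (M + 1) + |r| + 1) * C * (1 + x ^ 2)) := by
            gcongr
            have : (2 * s * (M + |x|) + |r|) + 1 ≤ (2 * s * (M + 1) + |r| + 1) * (1 + x ^ 2) := by
              have e1 : 2 * s * |x| ≤ 2 * s * (1 + x ^ 2) := by gcongr
              have e2 : 0 ≤ (2 * s * M + |r| + 1) * x ^ 2 := by positivity
              nlinarith
            nlinarith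
        _ = _ := by rw [hK]; ring
    · refine (ae_restrict_iff' measurableSet_Ioi).2 (.of_forall fun x hx w hw => ?_)
      exact (hasDerivAt_gaussExp_mul (s := s) hk r
        (hne (hw.1 x (le_of_lt hx)))).comp_add_const w (σ * Complex.I * x)
  have hlim : Tendsto (fun x : ℝ => gaussExp s r (w₀ + σ * Complex.I * x) *
      k (w₀ + σ * Complex.I * x)) atTop (𝓝 0) := by
    have h1 : Tendsto (fun x : ℝ => Real.exp (2 * s * ‖w₀‖ ^ 2 + |r| * ‖w₀‖) *
        Real.exp (-(s / 2) * x ^ 2) * C) atTop (𝓝 0) := by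
      have h2 : Tendsto (fun x : ℝ => -(s / 2) * x ^ 2) atTop atBot :=
        (tendsto_pow_atTop two_ne_zero).const_mul_atTop_of_neg (by linarith)
      simpa using ((Real.tendsto_exp_atBot.comp h2).const_mul
        (Real.exp (2 * s * ‖w₀‖ ^ 2 + |r| * ‖w₀‖))).mul_const C
    refine squeeze_zero_norm' ?_ h1
    filter_upwards [eventually_ge_atTop 0] with x hx
    rw [norm_mul]
    exact mul_le_mul (norm_gaussExp_ray_le hs hσ le_rfl x)
        (hC _ (h0 x hx)).1 (norm_nonneg _) (by positivity)
  have hftc := integral_Ioi_of_hasDerivAt_of_tendsto' (a := (0 : ℝ))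
    (f := fun x : ℝ => gaussExp s r (w₀ + σ * Complex.I * x) * k (w₀ + σ * Complex.I * x))
    (f' := fun x : ℝ => (σ * Complex.I) * F' (w₀ + σ * Complex.I * x)) (fun x hx => ?_)
    (hint.const_mul _) hlim
  · have := hder.const_mul (-((σ : ℂ) * Complex.I))
    unfold rayPrimitive
    convert! this using 1
    rw [integral_const_mul] at hftc
    rw [neg_mul, hftc]
    simp
  · have h1 : HasDerivAt (fun x : ℝ => w₀ + σ * Complex.I * x) (σ * Complex.I) x := by
      simpa using! (Complex.ofRealCLM.hasDerivAt (x := x)).const_mul (σ * Complex.I) |>.const_add w₀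
    have := (hasDerivAt_gaussExp_mul (s := s) hk r (hne (h0 x hx))).comp x h1
    convert! this using 1
    ring

end Ray

/-! ### Deformation of a contour to a vertical line -/

section Contour

variable {a : ℝ} {k k' : ℂ → ℂ} {s : ℝ}

/-- A ray that starts off the real axis and moves away from it, or a vertical ray to the right of
`a`, stays at a positive distance from the real point `a`, and so do the rays from nearby points. -/
lemma eventually_le_norm_ray {σ : ℝ} (hσ : σ ^ 2 = 1) {w₀ : ℂ} (h : 0 < σ * w₀.im ∨ a < w₀.re) :
    ∃ δ > 0, ∀ᶠ w in 𝓝 w₀, ∀ x : ℝ, 0 ≤ x → δ ≤ ‖w + σ * Complex.I * x - a‖ := by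
  rcases h with h | h
  · refine ⟨σ * w₀.im / 2, by positivity, ?_⟩
    have : ∀ᶠ w : ℂ in 𝓝 w₀, σ * w₀.im / 2 < σ * w.im :=
      (by fun_prop : Continuous fun w : ℂ => σ * w.im).continuousAt.eventually
        (lt_mem_nhds (by linarith))
    filter_upwards [this] with w hw x hx
    have habsσ : |σ| = 1 := by
      rw [← abs_one, ← sq_eq_sq_iff_abs_eq_abs, hσ, one_pow]
    have h1 := Complex.abs_im_le_norm (w + σ * Complex.I * x - a)
    simp at h1
    have h2 := le_abs_self (σ * (w.im + σ * x))
    rw [abs_mul, habsσ, one_mul] at h2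
    nlinarith
  · refine ⟨(w₀.re - a) / 2, by linarith, ?_⟩
    have : ∀ᶠ w : ℂ in 𝓝 w₀, (w₀.re + a) / 2 < w.re :=
      Complex.continuous_re.continuousAt.eventually (lt_mem_nhds (by linarith))
    filter_upwards [this] with w hw x hx
    have h1 := Complex.abs_re_le_norm (w + σ * Complex.I * x - a)
    simp at h1
    linarith [le_abs_self (w.re - a)]

lemma BoundedDerivOff.hasDerivAt_rayPrimitive' (hk : BoundedDerivOff a k k') (hs : 0 < s) (r : ℝ)
    {σ : ℝ} (hσ : σ ^ 2 = 1) {w₀ : ℂ} (h : 0 < σ * w₀.im ∨ a < w₀.re) :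
    HasDerivAt (rayPrimitive σ fun w => gaussExp s r w * k w) (gaussExp s r w₀ * k w₀) w₀ := by
  obtain ⟨δ, hδ, h'⟩ := eventually_le_norm_ray hσ h
  exact hk.hasDerivAt_rayPrimitive hs r hσ hδ h'

/-- The integral of `F` along the vertical line `Re w = c`, parametrized by the imaginary part. -/
def lineIntegral (F : ℂ → ℂ) (c : ℝ) : ℂ := ∫ x : ℝ, F (c + x * Complex.I)

lemma BoundedDerivOff.integrableOn_ray' (hk : BoundedDerivOff a k k') (hs : 0 < s) (r : ℝ)
    {σ : ℝ} (hσ : σ ^ 2 = 1) {w : ℂ} (h : 0 < σ * w.im ∨ a < w.re) :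
    IntegrableOn
      (fun x : ℝ => gaussExp s r (w + σ * Complex.I * x) * k (w + σ * Complex.I * x)) (Ioi 0) := by
  obtain ⟨δ, hδ, h'⟩ := eventually_le_norm_ray hσ h
  exact hk.integrableOn_ray hs r hσ hδ h'.self_of_nhds

/-- The upward and the downward ray from `c` together sweep the whole vertical line. -/
lemma BoundedDerivOff.rayPrimitive_sub (hk : BoundedDerivOff a k k') (hs : 0 < s) (r : ℝ)
    {c : ℝ} (hc : a < c) :
    rayPrimitive (-1) (fun w => gaussExp s r w * k w) c -
      rayPrimitive 1 (fun w => gaussExp s r w * k w) c =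
      Complex.I * lineIntegral (fun w => gaussExp s r w * k w) c := by
  have h1 := hk.integrableOn_ray' hs r (σ := 1) (by norm_num) (w := c) (Or.inr (by simpa using hc))
  have h2 := hk.integrableOn_ray' hs r (σ := -1) (by norm_num) (w := c)
    (Or.inr (by simpa using hc))
  set f : ℝ → ℂ := fun x => gaussExp s r (c + x * Complex.I) * k (c + x * Complex.I) with hf
  have e1 : (fun x : ℝ => gaussExp s r (c + ((1 : ℝ) : ℂ) * Complex.I * x) *
      k (c + ((1 : ℝ) : ℂ) * Complex.I * x)) = f := by
    funext x; simp [hf, mul_comm]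
  have e2 : (fun x : ℝ => gaussExp s r (c + ((-1 : ℝ) : ℂ) * Complex.I * x) *
      k (c + ((-1 : ℝ) : ℂ) * Complex.I * x)) = fun x => f (-x) := by
    funext x; simp [hf, mul_comm]
  rw [e1] at h1
  rw [e2] at h2
  have h3 : IntegrableOn f (Iic 0) := by
    have h := ((Measure.measurePreserving_neg (volume : Measure ℝ)).integrableOn_comp_preimage
      (Homeomorph.neg ℝ).measurableEmbedding (f := f) (s := Iio 0)).1
      (by simpa [Function.comp_def] using h2)
    exact (integrableOn_Iic_iff_integrableOn_Iio (by simp)).2 h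
  have h4 : ∫ x in Ioi (0 : ℝ), f (-x) = ∫ x in Iic (0 : ℝ), f x := by
    simp
  have h5 := intervalIntegral.integral_Iic_add_Ioi h3 h1
  unfold rayPrimitive lineIntegral
  rw [e1, e2, h4, ← h5]
  push_cast
  ring

/-- Both ray primitives are antiderivatives of the same function on the half plane `Re > a`, so
their difference is constant there. This also makes the line integral independent of the abscissa.
-/
lemma BoundedDerivOff.rayPrimitive_sub_of_lt_re (hk : BoundedDerivOff a k k') (hs : 0 < s) (r : ℝ)
    {c : ℝ} (hc : a < c) {w : ℂ} (hw : a < w.re) :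
    rayPrimitive (-1) (fun w => gaussExp s r w * k w) w -
      rayPrimitive 1 (fun w => gaussExp s r w * k w) w =
      Complex.I * lineIntegral (fun w => gaussExp s r w * k w) c := by
  rw [← hk.rayPrimitive_sub hs r hc]
  have hder : ∀ z ∈ {z : ℂ | a < z.re}, HasDerivAt (fun z =>
      rayPrimitive (-1) (fun w => gaussExp s r w * k w) z -
      rayPrimitive 1 (fun w => gaussExp s r w * k w) z) 0 z := by
    intro z hz
    simpa using! (hk.hasDerivAt_rayPrimitive' hs r (σ := -1) (by norm_num) (Or.inr hz)).sub
      (hk.hasDerivAt_rayPrimitive' hs r (σ := 1) (by norm_num) (Or.inr hz))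
  exact (isOpen_lt continuous_const Complex.continuous_re).is_const_of_deriv_eq_zero
    (convex_halfSpace_re_gt a).isPreconnected
    (fun z hz => (hder z hz).differentiableAt.differentiableWithinAt)
    (fun z hz => (hder z hz).deriv) hw (show a < ((c : ℝ) : ℂ).re by simpa using hc)

lemma BoundedDerivOff.lineIntegral_eq (hk : BoundedDerivOff a k k') (hs : 0 < s) (r : ℝ)
    {c c' : ℝ} (hc : a < c) (hc' : a < c') :
    lineIntegral (fun w => gaussExp s r w * k w) c =
      lineIntegral (fun w => gaussExp s r w * k w) c' := by
  apply mul_left_cancel₀ Complex.I_ne_zero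
  rw [← hk.rayPrimitive_sub hs r hc,
    hk.rayPrimitive_sub_of_lt_re hs r hc' (show a < ((c : ℝ) : ℂ).re by simpa using hc)]

/-- Moving away from the real axis only helps: `(Im w + σx)² ≥ (Im w)² + x²`, so the integrand is at
most `C e^{s Re w²} e^{-s x²}`. The hypotheses `r ≥ 0` and `Re w ≥ 0` dispose of `e^{-rw}`. -/
lemma BoundedDerivOff.tendsto_rayPrimitive (hk : BoundedDerivOff a k k') (hs : 0 < s) {r : ℝ}
    (hr : 0 ≤ r) {σ : ℝ} (hσ : σ ^ 2 = 1) {ι : Type*} {l : Filter ι} {w : ι → ℂ}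
    (hre : ∀ i, 0 ≤ (w i).re) (him : ∀ᶠ i in l, 0 < σ * (w i).im)
    (hl : Tendsto (fun i => ((w i) ^ 2).re) l atBot) :
    Tendsto (fun i => rayPrimitive σ (fun w => gaussExp s r w * k w) (w i)) l (𝓝 0) := by
  obtain ⟨C, hC0, hC⟩ := hk.bounded 1 one_pos
  have habsσ : |σ| = 1 := by
    rw [← abs_one, ← sq_eq_sq_iff_abs_eq_abs, hσ, one_pow]
  have hlim : Tendsto (fun i => ∫ x in Ioi (0 : ℝ),
      Real.exp (s * ((w i) ^ 2).re) * C * Real.exp (-s * x ^ 2)) l (𝓝 0) := by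
    simp_rw [integral_const_mul]
    have := (((Real.tendsto_exp_atBot.comp (hl.const_mul_atBot hs)).mul_const C).mul_const
      (∫ x in Ioi (0 : ℝ), Real.exp (-s * x ^ 2)))
    simpa using this
  refine squeeze_zero_norm' ?_ hlim
  filter_upwards [him, hl.eventually (eventually_le_atBot (-1))] with i hi hi2
  have hsq : ((w i) ^ 2).re = (w i).re ^ 2 - (w i).im ^ 2 := by simp [pow_two]
  -- The threshold `Re w² ≤ -1` forces `|Im w| ≥ 1`, so the ray keeps distance 1 from `a`, where `C`
  -- bounds `k`.
  have hone : 1 ≤ σ * (w i).im := by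
    by_contra! hlt
    have : (σ * (w i).im) ^ 2 < 1 := by nlinarith
    rw [mul_pow, hσ] at this
    nlinarith [sq_nonneg (w i).re]
  rw [rayPrimitive, norm_mul, norm_neg, norm_mul, Complex.norm_real, Complex.norm_I,
    Real.norm_eq_abs, habsσ, one_mul, one_mul]
  refine norm_integral_le_of_norm_le
    ((integrable_exp_neg_mul_sq hs).const_mul _).integrableOn ?_
  refine (ae_restrict_iff' measurableSet_Ioi).2 (.of_forall fun x hx => ?_)
  have hx0 : (0 : ℝ) < x := hx
  have h1 : 1 ≤ ‖w i + σ * Complex.I * x - a‖ := by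
    have h1 := Complex.abs_im_le_norm (w i + σ * Complex.I * x - a)
    simp at h1
    have h2 := le_abs_self (σ * ((w i).im + σ * x))
    rw [abs_mul, habsσ, one_mul] at h2
    nlinarith
  rw [norm_mul, norm_gaussExp, mul_right_comm (Real.exp (s * ((w i) ^ 2).re)), ← Real.exp_add]
  refine mul_le_mul (Real.exp_le_exp.2 ?_) (hC _ h1).1 (norm_nonneg _) (by positivity)
  have h2 : 0 ≤ r * (w i).re := mul_nonneg hr (hre i)
  rw [hsq]
  simp
  have h3 : (w i).im ^ 2 + x ^ 2 ≤ ((w i).im + σ * x) ^ 2 := by nlinarith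
  nlinarith

/-- Contour integrals of `e^{s w² - r w} k(w)` along curves that come from the lower end and go to
the upper end of the right half plane, on the right of `a`, equal the integral along any vertical
line on the right of `a`. -/
theorem BoundedDerivOff.integral_curve (hk : BoundedDerivOff a k k') (hs : 0 < s) {r : ℝ}
    (hr : 0 ≤ r) {c : ℝ} (hc : a < c) {w w' : ℝ → ℂ} {E : Set ℝ} (hE : E.Countable)
    (hw : Continuous w) (hd : ∀ τ, τ ∉ E → HasDerivAt w (w' τ) τ) (hre : ∀ τ, 0 ≤ (w τ).re)
    (hmem : ∀ τ, w τ - a ∈ Complex.slitPlane)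
    (hint : Integrable fun τ => gaussExp s r (w τ) * k (w τ) * w' τ)
    (htop : Tendsto (fun τ => ((w τ) ^ 2).re) atTop atBot) (itop : ∀ᶠ τ in atTop, 0 < (w τ).im)
    (hbot : Tendsto (fun τ => ((w τ) ^ 2).re) atBot atBot) (ibot : ∀ᶠ τ in atBot, (w τ).im < 0) :
    ∫ τ, gaussExp s r (w τ) * k (w τ) * w' τ =
      Complex.I * lineIntegral (fun w => gaussExp s r w * k w) c := by
  classical
  set F : ℂ → ℂ := fun w => gaussExp s r w * k w with hF
  set L := Complex.I * lineIntegral F c with hL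
  -- A primitive of `F` on the plane slit along `(-∞, a]`, glued from the two ray primitives. They
  -- differ by exactly `L` on `Re > a`, so the gluing is consistent. At the upper end `Ψ` tends to
  -- `L`, at the lower end to `0`.
  set Ψ : ℂ → ℂ := fun z =>
    if 0 < z.im ∨ a < z.re then rayPrimitive 1 F z + L else rayPrimitive (-1) F z with hΨ
  have hΨ₁ : ∀ z : ℂ, (0 < z.im ∨ a < z.re) → Ψ z = rayPrimitive 1 F z + L := fun z hz =>
    if_pos hz
  have hΨ₂ : ∀ z : ℂ, (z.im < 0 ∨ a < z.re) → Ψ z = rayPrimitive (-1) F z := by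
    intro z hz
    by_cases h : 0 < z.im ∨ a < z.re
    · have hz' : a < z.re := by
        rcases hz with hz | hz
        · exact h.resolve_left (by linarith)
        · exact hz
      rw [hΨ₁ z h, hL, ← hk.rayPrimitive_sub_of_lt_re hs r hc hz', hF]
      ring
    · exact if_neg h
  have hderiv : ∀ z : ℂ, z - a ∈ Complex.slitPlane → HasDerivAt Ψ (F z) z := by
    intro z hz
    have hz' : 0 < z.im ∨ z.im < 0 ∨ a < z.re := by
      rw [Complex.mem_slitPlane_iff] at hz
      simp only [Complex.sub_re, Complex.ofReal_re, Complex.sub_im, Complex.ofReal_im,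
        sub_zero, sub_pos] at hz
      rcases hz with hz | hz
      · exact Or.inr (Or.inr hz)
      · exact (lt_or_gt_of_ne hz).elim (fun h => Or.inr (Or.inl h)) Or.inl
    by_cases h : z.im < 0 ∨ a < z.re
    · have hopen : IsOpen {z : ℂ | z.im < 0 ∨ a < z.re} :=
        (isOpen_lt Complex.continuous_im continuous_const).union
          (isOpen_lt continuous_const Complex.continuous_re)
      refine (hk.hasDerivAt_rayPrimitive' hs r (σ := -1) (by norm_num)
        (h.imp_left fun h => by linarith)).congr_of_eventuallyEq ?_
      exact Filter.mem_of_superset (hopen.mem_nhds h) fun z hz => hΨ₂ z hz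
    · have h' : 0 < z.im := hz'.resolve_right h
      refine ((hk.hasDerivAt_rayPrimitive' hs r (σ := 1) (by norm_num)
        (Or.inl (by simpa using h'))).add_const L).congr_of_eventuallyEq ?_
      exact Filter.mem_of_superset ((isOpen_lt continuous_const Complex.continuous_im).mem_nhds h')
        fun z hz => hΨ₁ z (Or.inl hz)
  have hcont : Continuous fun τ => Ψ (w τ) :=
    continuous_iff_continuousAt.2 fun τ =>
      (hderiv _ (hmem τ)).continuousAt.comp hw.continuousAt
  have hftc : ∀ S : ℝ, ∫ τ in (-S)..S, F (w τ) * w' τ = Ψ (w S) - Ψ (w (-S)) := fun S =>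
    integral_eq_of_hasDerivAt_off_countable (fun τ => Ψ (w τ)) _ hE hcont.continuousOn
      (fun τ hτ => (hderiv _ (hmem τ)).comp τ (hd τ hτ.2)) hint.intervalIntegrable
  have hlim := intervalIntegral_tendsto_integral hint tendsto_neg_atTop_atBot
    (tendsto_id (α := ℝ) (x := atTop))
  refine tendsto_nhds_unique hlim ?_
  have h1 : Tendsto (fun S => Ψ (w S)) atTop (𝓝 L) := by
    have := (hk.tendsto_rayPrimitive hs hr (σ := 1) (by norm_num) hre
      (by simpa using itop) htop).add_const L
    rw [zero_add] at this
    refine this.congr' ?_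
    filter_upwards [itop] with τ hτ
    exact (hΨ₁ _ (Or.inl hτ)).symm
  have h2 : Tendsto (fun S => Ψ (w S)) atBot (𝓝 0) := by
    refine (hk.tendsto_rayPrimitive hs hr (σ := -1) (by norm_num) hre
      (by simpa using ibot) hbot).congr' ?_
    filter_upwards [ibot] with τ hτ
    exact (hΨ₂ _ (Or.inl hτ)).symm
  have h3 := h1.sub (h2.comp tendsto_neg_atTop_atBot)
  rw [sub_zero] at h3
  exact h3.congr fun S => (hftc S).symm

end Contour

/-! ### The substitution `λ = ν (μ² - |ξ|²)` -/

section MuRoot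

variable {ν : ℝ} {ξ : EuclideanSpace ℝ (Fin 2)} {lam : ℂ}

lemma muRoot_sq (hν : 0 < ν) : (ν : ℂ) * muRoot ν ξ lam ^ 2 = lam + (‖ξ‖ : ℂ) ^ 2 * ν := by
  have h1 : (Complex.sqrt (lam + (‖ξ‖ : ℂ) ^ 2 * ν)) ^ 2 = lam + (‖ξ‖ : ℂ) ^ 2 * ν := by
    rw [Complex.sqrt, ← Complex.cpow_nat_mul]; simp
  have h2 : ((Real.sqrt ν : ℝ) : ℂ) ^ 2 = ν := by
    rw [← Complex.ofReal_pow, Real.sq_sqrt hν.le]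
  rw [muRoot, mul_pow, h1, inv_pow, h2, ← mul_assoc,
    mul_inv_cancel₀ (Complex.ofReal_ne_zero.2 hν.ne'), one_mul]

lemma re_muRoot_pos (hν : 0 < ν) (h : lam + (‖ξ‖ : ℂ) ^ 2 * (ν : ℂ) ∈ Complex.slitPlane) :
    0 < (muRoot ν ξ lam).re := by
  set z := lam + (‖ξ‖ : ℂ) ^ 2 * (ν : ℂ) with hz
  have h1 : 0 < (Complex.sqrt z).re := by
    rw [Complex.sqrt, Complex.cpow_inv_two_re]
    apply Real.sqrt_pos.2
    have h2 : -‖z‖ < z.re := by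
      rcases Complex.mem_slitPlane_iff.1 h with h | h
      · linarith [norm_nonneg z]
      · have := Complex.abs_re_lt_norm.2 h
        linarith [neg_abs_le z.re]
    linarith
  rw [muRoot, ← Complex.ofReal_inv, Complex.re_ofReal_mul]
  have : 0 < Real.sqrt ν := Real.sqrt_pos.2 hν
  positivity

lemma muRoot_ne_zero (hν : 0 < ν) (h : lam + (‖ξ‖ : ℂ) ^ 2 * (ν : ℂ) ∈ Complex.slitPlane) :
    muRoot ν ξ lam ≠ 0 := fun h0 => by
  have := re_muRoot_pos hν h
  simp [h0] at this

/-- Once differentiability is known, the value follows from differentiating `ν μ² = λ + ν|ξ|²`. -/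
lemma hasDerivAt_muRoot (hν : 0 < ν) (h : lam + (‖ξ‖ : ℂ) ^ 2 * (ν : ℂ) ∈ Complex.slitPlane) :
    HasDerivAt (muRoot ν ξ) (1 / (2 * ν * muRoot ν ξ lam)) lam := by
  have hd : DifferentiableAt ℂ (muRoot ν ξ) lam := by
    unfold muRoot
    exact ((Complex.differentiableAt_sqrt h).comp lam
      (f := fun lam => lam + (‖ξ‖ : ℂ) ^ 2 * ν) (differentiableAt_id.add_const _)).const_mul _
  have h1 := (hd.hasDerivAt.pow 2).const_mul (ν : ℂ)
  have h2 : HasDerivAt (fun lam => (ν : ℂ) * muRoot ν ξ lam ^ 2) 1 lam := by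
    simp_rw [muRoot_sq hν]
    exact (hasDerivAt_id lam).add_const _
  have h3 := h1.unique h2
  have h4 : deriv (muRoot ν ξ) lam = 1 / (2 * ν * muRoot ν ξ lam) := by
    rw [one_div]
    apply eq_inv_of_mul_eq_one_left
    rw [← h3]
    simp
    ring
  exact h4 ▸ hd.hasDerivAt

lemma im_muRoot (hν : 0 < ν) : 2 * ν * (muRoot ν ξ lam).re * (muRoot ν ξ lam).im = lam.im := by
  have := congrArg Complex.im (muRoot_sq (ξ := ξ) (lam := lam) hν)
  rw [Complex.im_ofReal_mul, ← Complex.ofReal_pow, ← Complex.ofReal_mul] at this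
  simp [pow_two] at this
  linarith

/-- The factor `μ + |ξ|` cancels the one in the residual integrand, so the pole at `λ = 0` becomes a
simple pole at `μ = |ξ|`. -/
lemma eq_mul_muRoot (hν : 0 < ν) :
    lam = ν * ((muRoot ν ξ lam - ‖ξ‖) * (muRoot ν ξ lam + ‖ξ‖)) := by
  have := muRoot_sq (ξ := ξ) (lam := lam) hν
  linear_combination -this

lemma muRoot_ne_norm (hν : 0 < ν) (h : lam ≠ 0) : muRoot ν ξ lam ≠ ‖ξ‖ := fun h0 => by
  have := eq_mul_muRoot (ξ := ξ) (lam := lam) hν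
  rw [h0] at this
  simp at this
  exact h this

/-- A real `μ` in `(0, |ξ|]` comes from a real `λ ≤ 0`. Hence the image of an admissible path avoids
the slit ending at the pole `|ξ|`. -/
lemma muRoot_sub_mem_slitPlane (hν : 0 < ν)
    (h : lam + (‖ξ‖ : ℂ) ^ 2 * (ν : ℂ) ∈ Complex.slitPlane) (hlam : lam ∈ Complex.slitPlane) :
    muRoot ν ξ lam - ‖ξ‖ ∈ Complex.slitPlane := by
  have hre := re_muRoot_pos hν h
  by_contra hc
  rw [Complex.mem_slitPlane_iff, not_or] at hc
  simp only [Complex.sub_re, Complex.ofReal_re, Complex.sub_im, Complex.ofReal_im, sub_zero,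
    not_not, not_lt] at hc
  have him := im_muRoot (ξ := ξ) (lam := lam) hν
  rw [hc.2, mul_zero] at him
  have h1 := congrArg Complex.re (eq_mul_muRoot (ξ := ξ) (lam := lam) hν)
  rw [Complex.re_ofReal_mul] at h1
  simp [hc.2] at h1
  rcases Complex.mem_slitPlane_iff.1 hlam with h2 | h2
  · have h3 : ((muRoot ν ξ lam).re - ‖ξ‖) * ((muRoot ν ξ lam).re + ‖ξ‖) ≤ 0 :=
      mul_nonpos_of_nonpos_of_nonneg hc.1 (by positivity)
    nlinarith
  · exact h2 him.symm

lemma add_mem_slitPlane (hν : 0 < ν) (hlam : lam ∈ Complex.slitPlane) :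
    lam + (‖ξ‖ : ℂ) ^ 2 * (ν : ℂ) ∈ Complex.slitPlane := by
  rw [← Complex.ofReal_pow, ← Complex.ofReal_mul]
  rw [Complex.mem_slitPlane_iff] at *
  simp only [Complex.add_re, Complex.ofReal_re, Complex.add_im, Complex.ofReal_im, add_zero]
  refine hlam.imp_left fun h => ?_
  positivity

lemma exp_mul_eq_gaussExp (hν : 0 < ν) (t r : ℝ) :
    Complex.exp (lam * t) * Complex.exp (-muRoot ν ξ lam * r) =
      Real.exp (-ν * ‖ξ‖ ^ 2 * t) * gaussExp (ν * t) r (muRoot ν ξ lam) := by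
  rw [gaussExp, Complex.ofReal_exp, ← Complex.exp_add, ← Complex.exp_add]
  congr 1
  have := muRoot_sq (ξ := ξ) (lam := lam) hν
  push_cast
  linear_combination -(t : ℂ) * this

end MuRoot

/-! ### Admissible paths in the variable `μ` -/

/-- A continuous curve that escapes to infinity at both ends attains its minimal distance to `b`. -/
lemma exists_pos_le_norm_sub {w : ℝ → ℂ} (hw : Continuous w) {b : ℂ} (hb : ∀ τ, w τ ≠ b)
    (h : Tendsto (fun τ => ‖w τ‖) (cocompact ℝ) atTop) : ∃ δ > 0, ∀ τ, δ ≤ ‖w τ - b‖ := by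
  have h1 : Tendsto (fun τ => ‖w τ - b‖) (cocompact ℝ) atTop := by
    refine tendsto_atTop_mono (f := fun τ => ‖w τ‖ + -‖b‖) (fun τ => ?_)
      (tendsto_atTop_add_const_right _ _ h)
    have := norm_sub_norm_le (w τ) b
    linarith
  obtain ⟨τ₀, h₀⟩ := (hw.sub continuous_const).norm.exists_forall_le h1
  exact ⟨‖w τ₀ - b‖, norm_pos_iff.2 (sub_ne_zero.2 (hb τ₀)), h₀⟩

section Path

variable {ν : ℝ} {ξ : EuclideanSpace ℝ (Fin 2)} {γ : ℝ → ℂ} {k k' : ℂ → ℂ}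

lemma IsAdmissiblePath.continuous_muRoot (hγ : IsAdmissiblePath γ) (hν : 0 < ν) :
    Continuous fun τ => muRoot ν ξ (γ τ) :=
  continuous_iff_continuousAt.2 fun τ =>
    (hasDerivAt_muRoot hν (add_mem_slitPlane hν (hγ.mem_slitPlane τ))).continuousAt.comp
      hγ.continuous.continuousAt

lemma re_muRoot_sq (hν : 0 < ν) (lam : ℂ) :
    ((muRoot ν ξ lam) ^ 2).re = ν⁻¹ * (lam.re + ‖ξ‖ ^ 2 * ν) := by
  have := congrArg Complex.re (muRoot_sq (ξ := ξ) (lam := lam) hν)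
  rw [Complex.re_ofReal_mul, ← Complex.ofReal_pow, ← Complex.ofReal_mul] at this
  simp only [Complex.add_re, Complex.ofReal_re] at this
  field_simp
  linarith

lemma tendsto_re_muRoot_sq (hν : 0 < ν) {l : Filter ℝ}
    (h : Tendsto (fun τ => (γ τ).re) l atBot) :
    Tendsto (fun τ => ((muRoot ν ξ (γ τ)) ^ 2).re) l atBot := by
  simp_rw [re_muRoot_sq hν]
  exact (tendsto_atBot_add_const_right _ _ h).const_mul_atBot (inv_pos.2 hν)

/-- At both ends `Re μ² → -∞`, and `|μ| ≥ √(-Re μ²)`. -/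
lemma IsAdmissiblePath.tendsto_norm_muRoot (hγ : IsAdmissiblePath γ) (hν : 0 < ν) :
    Tendsto (fun τ => ‖muRoot ν ξ (γ τ)‖) (cocompact ℝ) atTop := by
  have h : Tendsto (fun τ => ((muRoot ν ξ (γ τ)) ^ 2).re) (cocompact ℝ) atBot := by
    rw [cocompact_eq_atBot_atTop]
    exact (tendsto_re_muRoot_sq hν hγ.re_atBot).sup (tendsto_re_muRoot_sq hν hγ.re_atTop)
  refine tendsto_atTop_mono (fun τ => ?_)
    (Real.tendsto_sqrt_atTop.comp (tendsto_neg_atBot_atTop.comp h))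
  apply Real.sqrt_le_iff.2 ⟨norm_nonneg _, _⟩
  rw [← norm_pow]
  exact (neg_le_abs _).trans (Complex.abs_re_le_norm _)

lemma IsAdmissiblePath.im_muRoot_pos (hγ : IsAdmissiblePath γ) (hν : 0 < ν) {τ : ℝ}
    (hτ : 0 < (γ τ).im) : 0 < (muRoot ν ξ (γ τ)).im := by
  have h := re_muRoot_pos hν (add_mem_slitPlane (ξ := ξ) hν (hγ.mem_slitPlane τ))
  rw [← im_muRoot (ξ := ξ) hν] at hτ
  exact pos_of_mul_pos_right hτ (by positivity)

lemma IsAdmissiblePath.im_muRoot_neg (hγ : IsAdmissiblePath γ) (hν : 0 < ν) {τ : ℝ}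
    (hτ : (γ τ).im < 0) : (muRoot ν ξ (γ τ)).im < 0 := by
  have h := re_muRoot_pos hν (add_mem_slitPlane (ξ := ξ) hν (hγ.mem_slitPlane τ))
  rw [← im_muRoot (ξ := ξ) hν] at hτ
  exact neg_of_mul_neg_right hτ (by positivity)

/-- The modulus of `e^{νtμ²}` is `e^{νt|ξ|²} e^{t Re λ}` and `|e^{-rμ}| ≤ 1`. Since `μ` stays away
from `0` and from `|ξ|` along the path, `1/μ` and `k(μ)` are bounded, and the integrability built
into admissibility gives the majorant. -/
lemma IsAdmissiblePath.integrable_gaussExp_muRoot (hγ : IsAdmissiblePath γ) (hν : 0 < ν)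
    (hk : BoundedDerivOff (‖ξ‖ : ℂ) k k') {t r : ℝ} (ht : 0 < t) (hr : 0 ≤ r) :
    Integrable fun τ => gaussExp (ν * t) r (muRoot ν ξ (γ τ)) * k (muRoot ν ξ (γ τ)) *
      (1 / (2 * ν * muRoot ν ξ (γ τ)) * deriv γ τ) := by
  have hslit := fun τ => add_mem_slitPlane (ξ := ξ) hν (hγ.mem_slitPlane τ)
  have hc := hγ.continuous_muRoot (ξ := ξ) hν
  have hn := hγ.tendsto_norm_muRoot (ξ := ξ) hν
  have hne : ∀ τ, muRoot ν ξ (γ τ) ≠ ‖ξ‖ := fun τ =>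
    muRoot_ne_norm hν (Complex.slitPlane_ne_zero (hγ.mem_slitPlane τ))
  obtain ⟨δ, hδ, h1⟩ := exists_pos_le_norm_sub hc hne hn
  obtain ⟨m, hm, h2⟩ := exists_pos_le_norm_sub hc (b := 0)
    (fun τ => muRoot_ne_zero hν (hslit τ)) hn
  simp only [sub_zero] at h2
  obtain ⟨C, hC0, hC⟩ := hk.bounded δ hδ
  refine ((hγ.integrable t ht).const_mul
    (Real.exp (ν * t * ‖ξ‖ ^ 2) * C * (2 * ν * m)⁻¹)).mono' ?_ (.of_forall fun τ => ?_)
  · have hkc : Continuous fun τ => k (muRoot ν ξ (γ τ)) :=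
      hk.continuousOn_self.comp_continuous hc hne
    have : Continuous fun τ => 1 / (2 * ν * muRoot ν ξ (γ τ)) :=
      continuous_const.div (by fun_prop) fun τ => by
        have := muRoot_ne_zero hν (hslit τ)
        exact mul_ne_zero (mul_ne_zero two_ne_zero (Complex.ofReal_ne_zero.2 hν.ne')) this
    exact ((((continuous_gaussExp _ _).comp hc).mul hkc).aestronglyMeasurable).mul
      (this.aestronglyMeasurable.mul (measurable_deriv γ).aestronglyMeasurable)
  · have e1 : ‖gaussExp (ν * t) r (muRoot ν ξ (γ τ))‖ ≤
        Real.exp (ν * t * ‖ξ‖ ^ 2) * Real.exp (t * (γ τ).re) := by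
      rw [norm_gaussExp, ← Real.exp_add]
      apply Real.exp_le_exp.2
      have h3 := re_muRoot_sq (ξ := ξ) hν (γ τ)
      have h4 : ((muRoot ν ξ (γ τ)) ^ 2).re =
        (muRoot ν ξ (γ τ)).re ^ 2 - (muRoot ν ξ (γ τ)).im ^ 2 := by simp [pow_two]
      have h5 : 0 ≤ r * (muRoot ν ξ (γ τ)).re := mul_nonneg hr (re_muRoot_pos hν (hslit τ)).le
      rw [← h4, h3]
      have h6 : ν * t * (ν⁻¹ * ((γ τ).re + ‖ξ‖ ^ 2 * ν)) = t * (γ τ).re + ν * t * ‖ξ‖ ^ 2 := by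
        field_simp
      linarith
    have e2 : ‖1 / (2 * ν * muRoot ν ξ (γ τ))‖ ≤ (2 * ν * m)⁻¹ := by
      rw [one_div, norm_inv, norm_mul, norm_mul, Complex.norm_real, Complex.norm_ofNat,
        Real.norm_of_nonneg hν.le]
      exact inv_anti₀ (by positivity) (by gcongr; exact h2 τ)
    rw [norm_mul, norm_mul, norm_mul]
    calc _ ≤ (Real.exp (ν * t * ‖ξ‖ ^ 2) * Real.exp (t * (γ τ).re)) * C *
          ((2 * ν * m)⁻¹ * ‖deriv γ τ‖) := by
          gcongr
          exact (hC _ (h1 τ)).1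
      _ = _ := by ring

lemma IsAdmissiblePath.integral_gaussExp_muRoot (hγ : IsAdmissiblePath γ) (hν : 0 < ν)
    (hk : BoundedDerivOff (‖ξ‖ : ℂ) k k') {t r c : ℝ} (ht : 0 < t) (hr : 0 ≤ r) (hc : ‖ξ‖ < c) :
    ∫ τ, gaussExp (ν * t) r (muRoot ν ξ (γ τ)) * k (muRoot ν ξ (γ τ)) *
      (1 / (2 * ν * muRoot ν ξ (γ τ)) * deriv γ τ) =
      Complex.I * lineIntegral (fun w => gaussExp (ν * t) r w * k w) c := by
  obtain ⟨E, hE, hd⟩ := hγ.differentiable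
  have hslit := fun τ => add_mem_slitPlane (ξ := ξ) hν (hγ.mem_slitPlane τ)
  exact hk.integral_curve (w := fun τ => muRoot ν ξ (γ τ)) (mul_pos hν ht) hr hc hE
    (hγ.continuous_muRoot hν)
    (fun τ hτ => (hasDerivAt_muRoot hν (hslit τ)).comp τ (hd τ hτ).hasDerivAt)
    (fun τ => (re_muRoot_pos hν (hslit τ)).le)
    (fun τ => muRoot_sub_mem_slitPlane hν (hslit τ) (hγ.mem_slitPlane τ))
    (hγ.integrable_gaussExp_muRoot hν hk ht hr)
    (tendsto_re_muRoot_sq hν hγ.re_atTop)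
    (hγ.im_atTop.mono fun _ => hγ.im_muRoot_pos hν)
    (tendsto_re_muRoot_sq hν hγ.re_atBot)
    (hγ.im_atBot.mono fun _ => hγ.im_muRoot_neg hν)

end Path

/-! ### The two contour integrals: heat kernel and residual factor -/

lemma lineIntegral_gaussExp {s : ℝ} (hs : 0 < s) (r c : ℝ) :
    lineIntegral (gaussExp s r) c = ((Real.sqrt (Real.pi / s) * Real.exp (-r ^ 2 / (4 * s)) : ℝ) : ℂ)
    := by
  -- On `w = c + ix` the exponent `s w² - r w` is `-s x² + i(2sc - r) x + (s c² - r c)`.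
  have h := integral_cexp_quadratic (b := -(s : ℂ)) (by simpa using hs)
    (Complex.I * (2 * s * c - r)) (s * c ^ 2 - r * c)
  have hs' : (s : ℂ) ≠ 0 := Complex.ofReal_ne_zero.2 hs.ne'
  rw [lineIntegral]
  trans (Real.pi / - -(s : ℂ)) ^ (1 / 2 : ℂ) * Complex.exp (s * c ^ 2 - r * c -
    (Complex.I * (2 * s * c - r)) ^ 2 / (4 * -(s : ℂ)))
  · rw [← h]
    congr 1
    funext x
    rw [gaussExp]
    congr 1
    ring_nf
    simp
    ring
  · rw [neg_neg, Complex.ofReal_mul, Real.sqrt_eq_rpow, Complex.ofReal_cpow (by positivity),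
      Complex.ofReal_exp]
    push_cast
    congr 2
    field_simp
    rw [Complex.I_sq]
    ring

/-- The one-dimensional heat kernel damped by `e^{-ν a² t}`. -/
def dampedHeat (ν a t r : ℝ) : ℝ :=
  (Real.sqrt (4 * Real.pi * ν * t))⁻¹ * Real.exp (-r ^ 2 / (4 * ν * t)) * Real.exp (-ν * a ^ 2 * t)

/-- The scalar factor of the residual kernel, as an integral over a vertical line. -/
def residualFactor (ν a t r : ℝ) : ℂ :=
  ((Real.pi * a)⁻¹ * Real.exp (-ν * a ^ 2 * t) : ℝ) *
    lineIntegral (fun w => gaussExp (ν * t) r w * (w - a)⁻¹) (a + 1)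

lemma sqrt_pi_div {ν t : ℝ} (hν : 0 < ν) (ht : 0 < t) :
    Real.sqrt (Real.pi / (ν * t)) = 2 * Real.pi * (Real.sqrt (4 * Real.pi * ν * t))⁻¹ := by
  rw [Real.sqrt_eq_iff_mul_self_eq (by positivity) (by positivity)]
  have : Real.sqrt (4 * Real.pi * ν * t) ^ 2 = 4 * Real.pi * ν * t :=
    Real.sq_sqrt (by positivity)
  have hne : Real.sqrt (4 * Real.pi * ν * t) ≠ 0 := (Real.sqrt_pos.2 (by positivity)).ne'
  rw [show 2 * Real.pi * (Real.sqrt (4 * Real.pi * ν * t))⁻¹ *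
    (2 * Real.pi * (Real.sqrt (4 * Real.pi * ν * t))⁻¹) =
    4 * Real.pi ^ 2 / Real.sqrt (4 * Real.pi * ν * t) ^ 2 by field_simp; ring, this]
  field_simp

section PathIntegrals

variable {ν : ℝ} {ξ : EuclideanSpace ℝ (Fin 2)} {γ : ℝ → ℂ}

/-- Here `k = 1`: the factor `1/(2νμ)` is exactly `dμ/dλ`, which leaves the Gaussian line integral.
-/
lemma IsAdmissiblePath.pathIntegral_heat (hγ : IsAdmissiblePath γ) (hν : 0 < ν)
    {t r : ℝ} (ht : 0 < t) (hr : 0 ≤ r) :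
    PathIntegrable γ (fun lam => Complex.exp (lam * t) *
      ((2 * ν * muRoot ν ξ lam)⁻¹ * Complex.exp (-muRoot ν ξ lam * r))) ∧
    pathIntegral γ (fun lam => Complex.exp (lam * t) *
      ((2 * ν * muRoot ν ξ lam)⁻¹ * Complex.exp (-muRoot ν ξ lam * r))) =
      dampedHeat ν ‖ξ‖ t r := by
  have hk := boundedDerivOff_one (‖ξ‖ : ℂ)
  have h1 := hγ.integrable_gaussExp_muRoot hν hk ht hr
  have h2 := hγ.integral_gaussExp_muRoot hν hk ht hr (lt_add_one _)
  simp only [mul_one] at h1 h2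
  have e : ∀ τ, Complex.exp (γ τ * t) * ((2 * ν * muRoot ν ξ (γ τ))⁻¹ *
      Complex.exp (-muRoot ν ξ (γ τ) * r)) * deriv γ τ = Real.exp (-ν * ‖ξ‖ ^ 2 * t) *
      (gaussExp (ν * t) r (muRoot ν ξ (γ τ)) * (1 / (2 * ν * muRoot ν ξ (γ τ)) * deriv γ τ)) := by
    intro τ
    rw [← mul_assoc (Real.exp _ : ℂ), ← exp_mul_eq_gaussExp hν, one_div]
    ring
  unfold PathIntegrable pathIntegral
  simp_rw [e]
  refine ⟨h1.const_mul _, ?_⟩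
  have h3 := lineIntegral_gaussExp (mul_pos hν ht) r (‖ξ‖ + 1)
  rw [integral_const_mul, h2, h3, sqrt_pi_div hν ht, dampedHeat]
  have : (Real.pi : ℂ) ≠ 0 := Complex.ofReal_ne_zero.2 Real.pi_ne_zero
  rw [← mul_assoc 4 ν t]
  push_cast
  field_simp

lemma IsAdmissiblePath.pathIntegral_residual (hγ : IsAdmissiblePath γ) (hν : 0 < ν) (hξ : ξ ≠ 0)
    {t r : ℝ} (ht : 0 < t) (hr : 0 ≤ r) :
    PathIntegrable γ (fun lam => Complex.exp (lam * t) *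
      ((muRoot ν ξ lam + (‖ξ‖ : ℂ)) / (muRoot ν ξ lam * lam * (‖ξ‖ : ℂ))) *
        Complex.exp (-muRoot ν ξ lam * r)) ∧
    pathIntegral γ (fun lam => Complex.exp (lam * t) *
      ((muRoot ν ξ lam + (‖ξ‖ : ℂ)) / (muRoot ν ξ lam * lam * (‖ξ‖ : ℂ))) *
        Complex.exp (-muRoot ν ξ lam * r)) =
      residualFactor ν ‖ξ‖ t r := by
  have hk := boundedDerivOff_inv (‖ξ‖ : ℂ)
  have h1 := hγ.integrable_gaussExp_muRoot hν hk ht hr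
  have h2 := hγ.integral_gaussExp_muRoot hν hk ht hr (lt_add_one _)
  have hξ' : (‖ξ‖ : ℂ) ≠ 0 := Complex.ofReal_ne_zero.2 (norm_ne_zero_iff.2 hξ)
  have e : ∀ τ, Complex.exp (γ τ * t) * ((muRoot ν ξ (γ τ) + (‖ξ‖ : ℂ)) /
      (muRoot ν ξ (γ τ) * γ τ * (‖ξ‖ : ℂ))) * Complex.exp (-muRoot ν ξ (γ τ) * r) * deriv γ τ =
      (2 / ‖ξ‖ * Real.exp (-ν * ‖ξ‖ ^ 2 * t)) *
      (gaussExp (ν * t) r (muRoot ν ξ (γ τ)) * (muRoot ν ξ (γ τ) - ‖ξ‖)⁻¹ *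
        (1 / (2 * ν * muRoot ν ξ (γ τ)) * deriv γ τ)) := by
    intro τ
    have hs := add_mem_slitPlane (ξ := ξ) hν (hγ.mem_slitPlane τ)
    have h0 := muRoot_ne_zero hν hs
    have h3 : muRoot ν ξ (γ τ) - ‖ξ‖ ≠ 0 := sub_ne_zero.2
      (muRoot_ne_norm hν (Complex.slitPlane_ne_zero (hγ.mem_slitPlane τ)))
    have h4 : muRoot ν ξ (γ τ) + ‖ξ‖ ≠ 0 := by
      intro h
      have h5 := congrArg Complex.re h
      have h6 := re_muRoot_pos hν hs
      simp at h5
      linarith [norm_nonneg ξ]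
    have hν' : (ν : ℂ) ≠ 0 := Complex.ofReal_ne_zero.2 hν.ne'
    -- By the factorization of `λ`, the coefficient is `2/|ξ|` times the amplitude `1/(μ - |ξ|)`
    -- times `dμ/dλ`.
    have h5 : (muRoot ν ξ (γ τ) + (‖ξ‖ : ℂ)) / (muRoot ν ξ (γ τ) * γ τ * (‖ξ‖ : ℂ)) =
        2 / ‖ξ‖ * (muRoot ν ξ (γ τ) - ‖ξ‖)⁻¹ * (1 / (2 * ν * muRoot ν ξ (γ τ))) := by
      have h6 := Complex.slitPlane_ne_zero (hγ.mem_slitPlane τ)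
      have h7 := eq_mul_muRoot (ξ := ξ) (lam := γ τ) hν
      field_simp
      linear_combination -h7
    rw [h5]
    linear_combination (2 / ‖ξ‖ * (muRoot ν ξ (γ τ) - ‖ξ‖)⁻¹ *
      (1 / (2 * ν * muRoot ν ξ (γ τ))) * deriv γ τ) *
      exp_mul_eq_gaussExp (ξ := ξ) (lam := γ τ) hν t r
  unfold PathIntegrable pathIntegral
  simp_rw [e]
  refine ⟨h1.const_mul _, ?_⟩
  rw [integral_const_mul, h2, residualFactor]
  have : (Real.pi : ℂ) ≠ 0 := Complex.ofReal_ne_zero.2 Real.pi_ne_zero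
  push_cast
  field_simp

end PathIntegrals

/-! ### Derivatives of line integrals in `r` and `s` -/

section LineIntegral

variable {k : ℂ → ℂ} {s r c C : ℝ}

lemma norm_gaussExp_line (s r c x : ℝ) : ‖gaussExp s r (c + x * Complex.I)‖ =
    Real.exp (s * c ^ 2 - r * c) * Real.exp (-s * x ^ 2) := by
  rw [norm_gaussExp, ← Real.exp_add]
  congr 1
  simp
  ring

lemma norm_line_sq_le (c x : ℝ) : ‖(c + x * Complex.I : ℂ)‖ ^ 2 ≤ (c ^ 2 + 1) * (1 + x ^ 2) := by
  rw [Complex.sq_norm, Complex.normSq_add_mul_I]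
  nlinarith [sq_nonneg (c * x)]

lemma norm_line_le (c x : ℝ) : ‖(c + x * Complex.I : ℂ)‖ ≤ (c ^ 2 + 2) * (1 + x ^ 2) := by
  have := norm_line_sq_le c x
  nlinarith [sq_nonneg (‖(c + x * Complex.I : ℂ)‖ - 1), sq_nonneg x]

lemma continuous_gaussExp_line (s r c : ℝ) :
    Continuous fun x : ℝ => gaussExp s r (c + x * Complex.I) :=
  (continuous_gaussExp s r).comp (by fun_prop)

lemma integrable_gaussExp_line (hs : 0 < s) (hkc : Continuous fun x : ℝ => k (c + x * Complex.I))
    (hkb : ∀ x : ℝ, ‖k (c + x * Complex.I)‖ ≤ C) :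
    Integrable fun x : ℝ => gaussExp s r (c + x * Complex.I) * k (c + x * Complex.I) := by
  refine ((integrable_exp_neg_mul_sq hs).const_mul (Real.exp (s * c ^ 2 - r * c) * C)).mono'
    ((continuous_gaussExp_line s r c).mul hkc).aestronglyMeasurable (.of_forall fun x => ?_)
  rw [norm_mul, norm_gaussExp_line]
  calc _ ≤ Real.exp (s * c ^ 2 - r * c) * Real.exp (-s * x ^ 2) * C := by gcongr; exact hkb x
    _ = _ := by ring

lemma norm_lineIntegral_le (hs : 0 < s) (hkb : ∀ x : ℝ, ‖k (c + x * Complex.I)‖ ≤ C) :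
    ‖lineIntegral (fun w => gaussExp s r w * k w) c‖ ≤
      Real.exp (s * c ^ 2 - r * c) * C * Real.sqrt (Real.pi / s) := by
  rw [← integral_gaussian, ← integral_const_mul]
  refine norm_integral_le_of_norm_le ((integrable_exp_neg_mul_sq hs).const_mul _)
    (.of_forall fun x => ?_)
  rw [norm_mul, norm_gaussExp_line]
  calc _ ≤ Real.exp (s * c ^ 2 - r * c) * Real.exp (-s * x ^ 2) * C := by gcongr; exact hkb x
    _ = _ := by ring

lemma hasDerivAt_lineIntegral_right (hs : 0 < s)
    (hkc : Continuous fun x : ℝ => k (c + x * Complex.I))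
    (hkb : ∀ x : ℝ, ‖k (c + x * Complex.I)‖ ≤ C) :
    Integrable (fun x : ℝ => gaussExp s r (c + x * Complex.I) *
      (-(c + x * Complex.I) * k (c + x * Complex.I))) ∧
    HasDerivAt (fun r => lineIntegral (fun w => gaussExp s r w * k w) c)
      (lineIntegral (fun w => gaussExp s r w * (-w * k w)) c) r := by
  refine hasDerivAt_integral_of_dominated_loc_of_deriv_le (μ := volume) (x₀ := r)
    (F := fun (r : ℝ) (x : ℝ) => gaussExp s r (c + x * Complex.I) * k (c + x * Complex.I))
    (F' := fun (r : ℝ) (x : ℝ) => gaussExp s r (c + x * Complex.I) *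
      (-(c + x * Complex.I) * k (c + x * Complex.I)))
    (bound := fun x => Real.exp (s * c ^ 2 + (|r| + 1) * |c|) * ((c ^ 2 + 2) * C) *
      ((1 + x ^ 2) * Real.exp (-s * x ^ 2)))
    (Metric.ball_mem_nhds r one_pos)
    (.of_forall fun r => ((continuous_gaussExp_line s r c).mul hkc).aestronglyMeasurable)
    (integrable_gaussExp_line hs hkc hkb)
    ((continuous_gaussExp_line s r c).mul
      (((by fun_prop : Continuous fun x : ℝ => -(c + x * Complex.I : ℂ))).mul
      hkc)).aestronglyMeasurable
    (.of_forall fun x ρ hρ => ?_) (integrable_one_add_sq_mul_exp hs _) (.of_forall fun x ρ _ => ?_)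
  · have h1 : -(ρ * c) ≤ (|r| + 1) * |c| := by
      refine (neg_le_abs _).trans ?_
      rw [abs_mul]
      gcongr
      rw [Metric.mem_ball, Real.dist_eq] at hρ
      have := abs_sub_abs_le_abs_sub ρ r
      linarith
    rw [norm_mul, norm_mul, norm_neg, norm_gaussExp_line]
    calc _ ≤ Real.exp (s * c ^ 2 + (|r| + 1) * |c|) * Real.exp (-s * x ^ 2) *
          ((c ^ 2 + 2) * (1 + x ^ 2) * C) := by
          gcongr
          · linarith
          · exact norm_line_le c x
          · exact hkb x
      _ = _ := by ring
  · set w : ℂ := c + x * Complex.I with hw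
    have h2 : HasDerivAt (fun ρ : ℝ => (s : ℂ) * w ^ 2 - (ρ : ℂ) * w) (-w) ρ := by
      simpa using! ((Complex.ofRealCLM.hasDerivAt (x := ρ)).mul_const w).const_sub (s * w ^ 2)
    convert! h2.cexp.mul_const (k w) using 1
    rw [gaussExp]
    ring

lemma hasDerivAt_lineIntegral_left (hs : 0 < s)
    (hkc : Continuous fun x : ℝ => k (c + x * Complex.I))
    (hkb : ∀ x : ℝ, ‖k (c + x * Complex.I)‖ ≤ C) :
    HasDerivAt (fun s => lineIntegral (fun w => gaussExp s r w * k w) c)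
      (lineIntegral (fun w => gaussExp s r w * (w ^ 2 * k w)) c) s := by
  refine (hasDerivAt_integral_of_dominated_loc_of_deriv_le (μ := volume) (x₀ := s)
    (F := fun (s : ℝ) (x : ℝ) => gaussExp s r (c + x * Complex.I) * k (c + x * Complex.I))
    (F' := fun (s : ℝ) (x : ℝ) => gaussExp s r (c + x * Complex.I) *
      ((c + x * Complex.I) ^ 2 * k (c + x * Complex.I)))
    -- The parameter ranges over `(s/2, 2s)`: the growing factor is bounded at the right end and the
    -- decaying one at the left end.
    (bound := fun x => Real.exp (2 * s * c ^ 2 - r * c) * ((c ^ 2 + 1) * C) *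
      ((1 + x ^ 2) * Real.exp (-(s / 2) * x ^ 2)))
    (Ioo_mem_nhds (show s / 2 < s by linarith) (show s < 2 * s by linarith))
    (.of_forall fun s => ((continuous_gaussExp_line s r c).mul hkc).aestronglyMeasurable)
    (integrable_gaussExp_line hs hkc hkb)
    ((continuous_gaussExp_line s r c).mul
      (((by fun_prop : Continuous fun x : ℝ => (c + x * Complex.I : ℂ) ^ 2)).mul
      hkc)).aestronglyMeasurable
    (.of_forall fun x ρ hρ => ?_) (integrable_one_add_sq_mul_exp (by positivity) _)
    (.of_forall fun x ρ _ => ?_)).2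
  · rw [norm_mul, norm_mul, norm_pow, norm_gaussExp_line]
    calc _ ≤ Real.exp (2 * s * c ^ 2 - r * c) * Real.exp (-(s / 2) * x ^ 2) *
          ((c ^ 2 + 1) * (1 + x ^ 2) * C) := by
          gcongr
          · exact hρ.2.le
          · exact hρ.1.le
          · exact norm_line_sq_le c x
          · exact hkb x
      _ = _ := by ring
  · set w : ℂ := c + x * Complex.I with hw
    have h2 : HasDerivAt (fun ρ : ℝ => (ρ : ℂ) * w ^ 2 - (r : ℂ) * w) (w ^ 2) ρ := by
      simpa using! ((Complex.ofRealCLM.hasDerivAt (x := ρ)).mul_const (w ^ 2)).sub_const (r * w)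
    convert! h2.cexp.mul_const (k w) using 1
    rw [gaussExp]
    ring

lemma hasDerivAt_lineIntegral_gaussExp (hs : 0 < s) (r c : ℝ) :
    HasDerivAt (fun r => lineIntegral (gaussExp s r) c)
      (-(r / (2 * s)) * lineIntegral (gaussExp s r) c) r := by
  simp_rw [lineIntegral_gaussExp hs]
  have h1 : HasDerivAt (fun r : ℝ => -r ^ 2 / (4 * s)) (-(r / (2 * s))) r := by
    convert! ((hasDerivAt_pow 2 r).neg).div_const (4 * s) using 1
    simp
    ring
  convert! ((h1.exp).const_mul (Real.sqrt (Real.pi / s))).ofReal_comp using 1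
  push_cast
  ring

/-- The first moment comes from computing the `r`-derivative twice: under the integral sign and from
the closed form. -/
lemma lineIntegral_mul_gaussExp (hs : 0 < s) (r c : ℝ) :
    Integrable (fun x : ℝ => gaussExp s r (c + x * Complex.I) * (c + x * Complex.I)) ∧
    lineIntegral (fun w => gaussExp s r w * w) c = r / (2 * s) * lineIntegral (gaussExp s r) c := by
  obtain ⟨h1, h2⟩ := hasDerivAt_lineIntegral_right (k := fun _ => 1) (r := r) (c := c) hs
    continuous_const (C := 1) (by simp)
  simp only [mul_one] at h1 h2
  have h3 := h2.unique (hasDerivAt_lineIntegral_gaussExp hs r c)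
  refine ⟨h1.neg.congr (.of_forall fun x => by simp; ring), ?_⟩
  simp only [lineIntegral, mul_neg, integral_neg] at h3 ⊢
  linear_combination -h3

lemma line_sub_ne_zero {a : ℝ} (hc : a < c) (x : ℝ) : (c + x * Complex.I : ℂ) - a ≠ 0 := by
  intro h
  have := congrArg Complex.re h
  simp at this
  linarith

lemma continuous_line_sub_inv {a : ℝ} (hc : a < c) :
    Continuous fun x : ℝ => ((c + x * Complex.I : ℂ) - a)⁻¹ :=
  Continuous.inv₀ (by fun_prop) (line_sub_ne_zero hc)

lemma norm_line_sub_inv_le {a : ℝ} (hc : a < c) (x : ℝ) :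
    ‖((c + x * Complex.I : ℂ) - a)⁻¹‖ ≤ (c - a)⁻¹ := by
  rw [norm_inv]
  refine inv_anti₀ (by linarith) ?_
  have h1 := Complex.abs_re_le_norm ((c + x * Complex.I : ℂ) - a)
  simp at h1
  linarith [le_abs_self (c - a)]

/-- Division with remainder: `-w/(w - a) = -a/(w - a) - 1`. -/
lemma hasDerivAt_lineIntegral_inv_right {a : ℝ} (hs : 0 < s) (hc : a < c) (r : ℝ) :
    HasDerivAt (fun r => lineIntegral (fun w => gaussExp s r w * (w - a)⁻¹) c)
      (-a * lineIntegral (fun w => gaussExp s r w * (w - a)⁻¹) c -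
        lineIntegral (gaussExp s r) c) r := by
  convert (hasDerivAt_lineIntegral_right (k := fun w => (w - a)⁻¹) (r := r) hs
    (continuous_line_sub_inv hc) (norm_line_sub_inv_le hc)).2 using 1
  have h1 := integrable_gaussExp_line (k := fun w => (w - a)⁻¹) (r := r) hs
    (continuous_line_sub_inv hc) (norm_line_sub_inv_le hc)
  have h2 := integrable_gaussExp_line (k := fun _ => 1) (r := r) (c := c) hs
    continuous_const (C := 1) (by simp)
  simp only [mul_one] at h2
  rw [lineIntegral, lineIntegral, lineIntegral, ← integral_const_mul,
    ← integral_sub (h1.const_mul _) h2]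
  congr 1
  funext x
  have := line_sub_ne_zero hc x
  field_simp
  ring

/-- Division with remainder: `w²/(w - a) = a²/(w - a) + a + w`, and the `w` term is the first moment
of the Gaussian. -/
lemma hasDerivAt_lineIntegral_inv_left {a : ℝ} (hs : 0 < s) (hc : a < c) (r : ℝ) :
    HasDerivAt (fun s => lineIntegral (fun w => gaussExp s r w * (w - a)⁻¹) c)
      (a ^ 2 * lineIntegral (fun w => gaussExp s r w * (w - a)⁻¹) c +
        (a + r / (2 * s)) * lineIntegral (gaussExp s r) c) s := by
  convert hasDerivAt_lineIntegral_left (k := fun w => (w - a)⁻¹) (r := r) hs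
    (continuous_line_sub_inv hc) (norm_line_sub_inv_le hc) using 1
  have h1 := integrable_gaussExp_line (k := fun w => (w - a)⁻¹) (r := r) hs
    (continuous_line_sub_inv hc) (norm_line_sub_inv_le hc)
  have h2 := integrable_gaussExp_line (k := fun _ => 1) (r := r) (c := c) hs
    continuous_const (C := 1) (by simp)
  simp only [mul_one] at h2
  obtain ⟨h3, h4⟩ := lineIntegral_mul_gaussExp hs r c
  have h5 : Integrable fun x : ℝ => a * gaussExp s r (c + x * Complex.I) +
      gaussExp s r (c + x * Complex.I) * (c + x * Complex.I) := (h2.const_mul _).add h3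
  rw [add_mul, ← h4]
  rw [lineIntegral, lineIntegral, lineIntegral, lineIntegral, ← integral_const_mul,
    ← integral_const_mul, ← integral_add (h2.const_mul _) h3, ← integral_add (h1.const_mul _) h5]
  congr 1
  funext x
  have := line_sub_ne_zero hc x
  field_simp
  ring

end LineIntegral

/-! ### Differential relations and small-time bound for the scalar factors -/

section Factors

variable {ν a t : ℝ}

lemma const_mul_lineIntegral (hν : 0 < ν) (ha : 0 < a) (ht : 0 < t) (r c : ℝ) :
    (((Real.pi * a)⁻¹ * Real.exp (-ν * a ^ 2 * t) : ℝ) : ℂ) *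
      lineIntegral (gaussExp (ν * t) r) c = 2 / a * dampedHeat ν a t r := by
  rw [lineIntegral_gaussExp (mul_pos hν ht), sqrt_pi_div hν ht, dampedHeat, ← mul_assoc 4 ν t,
    ← Complex.ofReal_mul]
  have h : ((Real.pi * a)⁻¹ * Real.exp (-ν * a ^ 2 * t)) *
    (2 * Real.pi * (Real.sqrt (4 * Real.pi * ν * t))⁻¹ * Real.exp (-r ^ 2 / (4 * ν * t))) =
    2 / a * ((Real.sqrt (4 * Real.pi * ν * t))⁻¹ * Real.exp (-r ^ 2 / (4 * ν * t)) *
      Real.exp (-ν * a ^ 2 * t)) := by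
    field_simp
  rw [h]
  push_cast
  ring

lemma hasDerivAt_dampedHeat (ν a t r : ℝ) :
    HasDerivAt (dampedHeat ν a t) (-(r / (2 * ν * t)) * dampedHeat ν a t r) r := by
  have h1 : HasDerivAt (fun r : ℝ => -r ^ 2 / (4 * ν * t)) (-(r / (2 * ν * t))) r := by
    convert! ((hasDerivAt_pow 2 r).neg).div_const (4 * ν * t) using 1
    simp
    ring
  convert! ((h1.exp).const_mul ((Real.sqrt (4 * Real.pi * ν * t))⁻¹)).mul_const
    (Real.exp (-ν * a ^ 2 * t)) using 1
  rw [dampedHeat]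
  ring

lemma contDiff_dampedHeat (ν a t : ℝ) {n : WithTop ℕ∞} : ContDiff ℝ n (dampedHeat ν a t) := by
  unfold dampedHeat
  fun_prop

lemma hasDerivAt_dampedHeat_time (hν : 0 < ν) (ht : 0 < t) (r : ℝ) :
    HasDerivAt (fun t => dampedHeat ν a t r)
      ((r ^ 2 / (4 * ν * t ^ 2) - 1 / (2 * t) - ν * a ^ 2) * dampedHeat ν a t r) t := by
  have h1 : HasDerivAt (fun t : ℝ => (Real.sqrt (4 * Real.pi * ν * t))⁻¹)
      (-(1 / (2 * t)) * (Real.sqrt (4 * Real.pi * ν * t))⁻¹) t := by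
    have hpos : 0 < 4 * Real.pi * ν * t := by positivity
    have h2 : HasDerivAt (fun t : ℝ => 4 * Real.pi * ν * t) (4 * Real.pi * ν) t := by
      simpa using (hasDerivAt_id t).const_mul (4 * Real.pi * ν)
    convert! (h2.sqrt hpos.ne').fun_inv (Real.sqrt_pos.2 hpos).ne' using 1
    have h3 := Real.sq_sqrt hpos.le
    have h4 := (Real.sqrt_pos.2 hpos).ne'
    set q := Real.sqrt (4 * Real.pi * ν * t)
    rw [h3]
    field_simp
  have h2 : HasDerivAt (fun t : ℝ => -r ^ 2 / (4 * ν * t)) (r ^ 2 / (4 * ν * t ^ 2)) t := by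
    have h3 : HasDerivAt (fun t : ℝ => 4 * ν * t) (4 * ν) t := by
      simpa using (hasDerivAt_id t).const_mul (4 * ν)
    convert! (hasDerivAt_const t (-r ^ 2)).fun_div h3 (by positivity) using 1
    field_simp
    ring
  have h3 : HasDerivAt (fun t : ℝ => -ν * a ^ 2 * t) (-ν * a ^ 2) t :=
    ((hasDerivAt_id' t).const_mul (-ν * a ^ 2)).congr_deriv (mul_one _)
  convert! (h1.fun_mul h2.exp).fun_mul h3.exp using 1
  rw [dampedHeat]
  ring

lemma hasDerivAt_residualFactor (hν : 0 < ν) (ha : 0 < a) (ht : 0 < t) (r : ℝ) :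
    HasDerivAt (residualFactor ν a t)
      (-a * residualFactor ν a t r - 2 / a * dampedHeat ν a t r) r := by
  convert! (hasDerivAt_lineIntegral_inv_right (mul_pos hν ht) (lt_add_one a) r).const_mul
    (((Real.pi * a)⁻¹ * Real.exp (-ν * a ^ 2 * t) : ℝ) : ℂ) using 1
  rw [← const_mul_lineIntegral hν ha ht r (a + 1), residualFactor]
  ring

/-- Bootstrapping: the first-order equation in `r` expresses the derivative through the function
itself and the smooth heat kernel. -/
lemma contDiff_residualFactor (hν : 0 < ν) (ha : 0 < a) (ht : 0 < t) (n : ℕ) :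
    ContDiff ℝ n (residualFactor ν a t) := by
  have hd := hasDerivAt_residualFactor hν ha ht
  have hderiv : deriv (residualFactor ν a t) =
      fun r => -a * residualFactor ν a t r - 2 / a * dampedHeat ν a t r :=
    funext fun r => (hd r).deriv
  have hdiff : Differentiable ℝ (residualFactor ν a t) := fun r => (hd r).differentiableAt
  induction n with
  | zero => simpa using hdiff.continuous
  | succ n ih =>
    have : ((n + 1 : ℕ) : WithTop ℕ∞) = n + 1 := by norm_cast
    rw [this, contDiff_succ_iff_deriv]
    refine ⟨hdiff, by simp, ?_⟩
    rw [hderiv]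
    exact (contDiff_const.mul ih).sub
      (contDiff_const.mul (Complex.ofRealCLM.contDiff.comp (contDiff_dampedHeat ν a t)))

/-- The damping `e^{-νa²t}` contributes `-νa² R`, which cancels the `a²` term of the `s`-derivative;
only the heat kernel survives. -/
lemma hasDerivAt_residualFactor_time (hν : 0 < ν) (ha : 0 < a) (ht : 0 < t) (r : ℝ) :
    HasDerivAt (fun t => residualFactor ν a t r)
      ((2 * ν + r / (a * t)) * dampedHeat ν a t r) t := by
  have h1 : HasDerivAt (fun t : ℝ => ν * t) ν t := by
    simpa using (hasDerivAt_id t).const_mul ν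
  have h2 := (hasDerivAt_lineIntegral_inv_left (mul_pos hν ht) (lt_add_one a) r).scomp t h1
  have h3 : HasDerivAt (fun t : ℝ => -ν * a ^ 2 * t) (-ν * a ^ 2) t :=
    ((hasDerivAt_id' t).const_mul (-ν * a ^ 2)).congr_deriv (mul_one _)
  convert! ((h3.exp.const_mul (Real.pi * a)⁻¹).ofReal_comp).mul h2 using 1
  have h4 := const_mul_lineIntegral hν ha ht r (a + 1)
  have hν' : (ν : ℂ) ≠ 0 := Complex.ofReal_ne_zero.2 hν.ne'
  have ha' : (a : ℂ) ≠ 0 := Complex.ofReal_ne_zero.2 ha.ne'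
  have ht' : (t : ℂ) ≠ 0 := Complex.ofReal_ne_zero.2 ht.ne'
  have h5 : (2 * ν + r / (a * t)) * (dampedHeat ν a t r : ℂ) =
      ν * (a + r / (2 * (ν * t))) * (2 / a * dampedHeat ν a t r) := by
    field_simp
  rw [h5, ← h4, Complex.real_smul]
  push_cast [Function.comp_apply]
  ring

/-- The abscissa `a + 1` in `residualFactor` is arbitrary, so the line may be moved to `a + δ` with
`δ = y/(2νt)`. As `νt δ = y/2`, the exponent is at most `ay` for every `r ≥ y`, while `δ⁻¹
√(π/(νt))` is of order `√t`. The bound thus vanishes as `t → 0`, uniformly in `r ≥ y`. -/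
lemma norm_residualFactor_le (hν : 0 < ν) (ha : 0 < a) (ht : 0 < t) {y r : ℝ} (hy : 0 < y)
    (hr : y ≤ r) : ‖residualFactor ν a t r‖ ≤
      (Real.pi * a)⁻¹ * (Real.exp (a * y) * (2 / y) * (Real.sqrt Real.pi * Real.sqrt (ν * t))) := by
  have hs : 0 < ν * t := mul_pos hν ht
  set s := ν * t with hsdef
  set δ := y / (2 * s) with hδ
  have hδ0 : 0 < δ := by positivity
  have h1 := (boundedDerivOff_inv (a : ℂ)).lineIntegral_eq hs r (lt_add_one a)
    (lt_add_of_pos_right a hδ0)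
  have h2 := norm_lineIntegral_le (k := fun w => (w - a)⁻¹) (r := r) hs
    (norm_line_sub_inv_le (lt_add_of_pos_right a hδ0))
  rw [residualFactor, ← hsdef, h1, norm_mul, Complex.norm_real, Real.norm_of_nonneg (by positivity),
    mul_assoc]
  refine mul_le_mul_of_nonneg_left ?_ (by positivity)
  calc _ ≤ Real.exp (-ν * a ^ 2 * t) * (Real.exp (s * (a + δ) ^ 2 - r * (a + δ)) *
        (a + δ - a)⁻¹ * Real.sqrt (Real.pi / s)) :=
        mul_le_mul_of_nonneg_left h2 (by positivity)
    _ = Real.exp (-ν * a ^ 2 * t + (s * (a + δ) ^ 2 - r * (a + δ))) *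
        (δ⁻¹ * Real.sqrt (Real.pi / s)) := by
        rw [Real.exp_add, add_sub_cancel_left]; ring
    _ ≤ Real.exp (a * y) * (δ⁻¹ * Real.sqrt (Real.pi / s)) := by
        gcongr
        have h3 : s * δ = y / 2 := by rw [hδ]; field_simp
        have h4 : y * δ ≤ r * δ := by gcongr
        have h5 : 0 ≤ r * a := mul_nonneg (hy.le.trans hr) ha.le
        have h6 : 0 ≤ y * δ := by positivity
        have h7 : -ν * a ^ 2 * t + (s * (a + δ) ^ 2 - r * (a + δ)) =
          2 * a * (s * δ) + (s * δ) * δ - r * a - r * δ := by rw [hsdef]; ring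
        rw [h7, h3]
        nlinarith
    _ = _ := by
        rw [Real.sqrt_div Real.pi_pos.le, hδ]
        have h3 := Real.mul_self_sqrt hs.le
        have h4 : Real.sqrt s ≠ 0 := (Real.sqrt_pos.2 hs).ne'
        field_simp
        rw [pow_two, h3]

end Factors

/-! ### Integration by parts with an indefinite integral -/

section IntegrationByParts

variable {φ φ' g W : ℝ → ℂ} {a b : ℝ}

/-- On `[x, z]` the factor `φ z - φ s` is `O(z - x)` and `∫ |g|` tends to `0`, so the integral is
`o(z - x)`. No pointwise information on `g` enters. -/
lemma hasDerivWithinAt_integral_sub_mul {x : ℝ} (hxb : x < b)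
    (hφ : ∀ z, HasDerivAt φ (φ' z) z) (hφ' : Continuous φ') (hg : IntervalIntegrable g volume x b) :
    HasDerivWithinAt (fun z => ∫ s in x..z, (φ z - φ s) * g s) 0 (Ici x) x := by
  obtain ⟨L, hL⟩ := isCompact_Icc.exists_bound_of_continuousOn (s := Icc x b) hφ'.continuousOn
  have hL0 : 0 ≤ L := (norm_nonneg _).trans (hL x (left_mem_Icc.2 hxb.le))
  have hlip : ∀ z ∈ Icc x b, ∀ s ∈ Icc x b, ‖φ z - φ s‖ ≤ L * ‖z - s‖ := fun z hz s hs =>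
    (convex_Icc x b).norm_image_sub_le_of_norm_hasDerivWithin_le
      (fun u _ => (hφ u).hasDerivWithinAt) hL hs hz
  rw [hasDerivWithinAt_iff_isLittleO, Asymptotics.isLittleO_iff]
  have hlim : Tendsto (fun z => L * ∫ s in x..z, ‖g s‖) (𝓝[Ici x] x) (𝓝 0) := by
    have h1 := intervalIntegral.continuousOn_primitive_interval' hg.norm left_mem_uIcc
    rw [uIcc_of_le hxb.le] at h1
    have h2 : ContinuousWithinAt (fun z => ∫ s in x..z, ‖g s‖) (Ici x) x :=
      (h1 x (left_mem_Icc.2 hxb.le)).mono_of_mem_nhdsWithin (Icc_mem_nhdsGE hxb)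
    have h3 := h2.tendsto.const_mul L
    simpa using h3
  intro c hc
  filter_upwards [hlim.eventually (gt_mem_nhds hc), Icc_mem_nhdsGE hxb] with z hz hzI
  have hgz : IntervalIntegrable g volume x z :=
    hg.mono_set (by rw [uIcc_of_le hzI.1, uIcc_of_le hxb.le]; exact Icc_subset_Icc_right hzI.2)
  simp only [intervalIntegral.integral_same, sub_zero, smul_zero]
  have hnorm : ‖z - x‖ = z - x := Real.norm_of_nonneg (by linarith [hzI.1])
  calc ‖∫ s in x..z, (φ z - φ s) * g s‖ ≤ ∫ s in x..z, L * (z - x) * ‖g s‖ := by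
        refine intervalIntegral.norm_integral_le_of_norm_le hzI.1 (.of_forall fun s hs => ?_)
          (hgz.norm.const_mul _)
        rw [norm_mul]
        gcongr
        refine (hlip z hzI s ⟨hs.1.le, hs.2.trans hzI.2⟩).trans ?_
        gcongr
        rw [Real.norm_of_nonneg (by linarith [hs.2])]
        linarith [hs.1]
    _ = (L * ∫ s in x..z, ‖g s‖) * (z - x) := by
        rw [intervalIntegral.integral_const_mul]; ring
    _ ≤ c * ‖z - x‖ := by
        rw [hnorm]
        exact mul_le_mul_of_nonneg_right hz.le (by linarith [hzI.1])

lemma continuousOn_of_eq_integral (hab : a ≤ b) (hg : IntervalIntegrable g volume a b)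
    (hW : ∀ z ∈ Icc a b, W z = W a + ∫ s in a..z, g s) : ContinuousOn W (Icc a b) := by
  have := intervalIntegral.continuousOn_primitive_interval' hg left_mem_uIcc
  rw [uIcc_of_le hab] at this
  exact (continuousOn_const.add this).congr hW

/-- Integration by parts for a `C¹` function and an indefinite integral. -/
theorem mul_sub_mul_eq_integral_of_eq_integral (hab : a ≤ b) (hφ : ∀ z, HasDerivAt φ (φ' z) z)
    (hφ' : Continuous φ') (hg : IntervalIntegrable g volume a b)
    (hW : ∀ z ∈ Icc a b, W z = W a + ∫ s in a..z, g s) :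
    φ b * W b - φ a * W a = ∫ s in a..b, (φ' s * W s + φ s * g s) := by
  have hφc : Continuous φ := continuous_iff_continuousAt.2 fun z => (hφ z).continuousAt
  have hWc := continuousOn_of_eq_integral hab hg hW
  have hsub : ∀ {c d}, c ∈ Icc a b → d ∈ Icc a b → uIcc c d ⊆ uIcc a b := fun hc hd => by
    rw [uIcc_of_le hab]; exact uIcc_subset_Icc hc hd
  have hi1 : IntervalIntegrable (fun s => φ' s * W s) volume a b :=
    (hφ'.continuousOn.mul (by rwa [uIcc_of_le hab])).intervalIntegrable
  have hi2 : IntervalIntegrable (fun s => φ s * g s) volume a b :=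
    hg.continuousOn_mul hφc.continuousOn
  have hmono : ∀ {h : ℝ → ℂ} {c d}, IntervalIntegrable h volume a b → c ∈ Icc a b → d ∈ Icc a b →
    IntervalIntegrable h volume c d := fun hh hc hd => hh.mono_set (hsub hc hd)
  have haI : a ∈ Icc a b := left_mem_Icc.2 hab
  set D : ℝ → ℂ := fun z => φ z * W z - ∫ s in a..z, (φ' s * W s + φ s * g s) with hD
  have hcont : ContinuousOn D (Icc a b) := by
    have := intervalIntegral.continuousOn_primitive_interval' (hi1.add hi2) left_mem_uIcc
    rw [uIcc_of_le hab] at this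
    exact (hφc.continuousOn.mul hWc).sub this
  have hder : ∀ x ∈ Ico a b, HasDerivWithinAt D 0 (Ici x) x := by
    intro x hx
    have hxI : x ∈ Icc a b := Ico_subset_Icc_self hx
    have hbI : b ∈ Icc a b := right_mem_Icc.2 hab
    have hc : ContinuousOn (fun s => φ' s * W s) (Icc x b) :=
      hφ'.continuousOn.mul (hWc.mono (Icc_subset_Icc_left hx.1))
    have h1 : HasDerivWithinAt (fun z => ∫ s in x..z, φ' s * W s) (φ' x * W x) (Ici x) x := by
      have hcw : ContinuousWithinAt (fun s => φ' s * W s) (Ioi x) x :=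
        (hc x (left_mem_Icc.2 hx.2.le)).mono_of_mem_nhdsWithin
          (Filter.mem_of_superset (Ioc_mem_nhdsGT hx.2) Ioc_subset_Icc_self)
      refine intervalIntegral.integral_hasDerivWithinAt_right (hmono hi1 hxI hxI) ?_ hcw
      exact ⟨Ioc x b, Ioc_mem_nhdsGT hx.2,
        (hc.mono Ioc_subset_Icc_self).aestronglyMeasurable measurableSet_Ioc⟩
    have h2 := hasDerivWithinAt_integral_sub_mul hx.2 hφ hφ' (hmono hg hxI hbI)
    -- To the right of `x`, `D` equals this expression. The terms with `g`, which need not be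
    -- differentiable separately at `x`, are collected in `∫ (φ z - φ s) g s`, whose right
    -- derivative is zero. Hence `D` has zero right derivative at every point, not merely almost
    -- everywhere.
    have h3 : HasDerivWithinAt (fun z => φ z * W x - (∫ s in x..z, φ' s * W s) +
        (∫ s in x..z, (φ z - φ s) * g s) - ∫ s in a..x, (φ' s * W s + φ s * g s)) 0 (Ici x) x := by
      have := ((((hφ x).hasDerivWithinAt (s := Ici x)).mul_const (W x)).sub h1 |>.add h2).sub_const
        (∫ s in a..x, (φ' s * W s + φ s * g s))
      simpa using! this
    refine h3.congr_of_eventuallyEq_of_mem ?_ self_mem_Ici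
    filter_upwards [Icc_mem_nhdsGE hx.2] with z hz
    have hzI : z ∈ Icc a b := ⟨hx.1.trans hz.1, hz.2⟩
    have e1 : W z = W x + ∫ s in x..z, g s := by
      rw [hW z hzI, hW x hxI, add_assoc, intervalIntegral.integral_add_adjacent_intervals
        (hmono hg haI hxI) (hmono hg hxI hzI)]
    have e2 : ∫ s in x..z, (φ z - φ s) * g s = φ z * (∫ s in x..z, g s) - ∫ s in x..z, φ s * g s := by
      rw [← intervalIntegral.integral_const_mul, ← intervalIntegral.integral_sub
        ((hmono hg hxI hzI).const_mul _) (hmono hi2 hxI hzI)]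
      simp_rw [sub_mul]
    have e3 := intervalIntegral.integral_add_adjacent_intervals
      (hmono (hi1.add hi2) haI hxI) (hmono (hi1.add hi2) hxI hzI)
    have e4 := intervalIntegral.integral_add (hmono hi1 hxI hzI) (hmono hi2 hxI hzI)
    simp only [hD]
    rw [← e3, e4, e2, e1]
    ring
  have hconst := constant_of_has_deriv_right_zero hcont hder b (right_mem_Icc.2 hab)
  simp only [hD, intervalIntegral.integral_same, sub_zero] at hconst
  linear_combination hconst

end IntegrationByParts

/-! ### Exponentials tested against `v'' - μ² v` -/

lemma memLp_two_of_norm_le_exp {f : ℝ → ℂ} {C κ : ℝ} (hκ : 0 < κ) (hf : ContinuousOn f (Ici 0))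
    (hb : ∀ z, 0 ≤ z → ‖f z‖ ≤ C * Real.exp (-κ * z)) :
    MemLp f 2 (volume.restrict (Ioi 0)) := by
  have hm : AEStronglyMeasurable f (volume.restrict (Ioi 0)) :=
    (hf.mono Ioi_subset_Ici_self).aestronglyMeasurable measurableSet_Ioi
  refine (memLp_two_iff_integrable_sq_norm hm).2 ?_
  refine Integrable.mono' (g := fun z => C ^ 2 * Real.exp (-(2 * κ) * z))
    ((exp_neg_integrableOn_Ioi 0 (by positivity)).const_mul _) (hm.norm.pow 2) ?_
  refine (ae_restrict_iff' measurableSet_Ioi).2 (.of_forall fun z hz => ?_)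
  rw [Real.norm_of_nonneg (by positivity)]
  calc ‖f z‖ ^ 2 ≤ (C * Real.exp (-κ * z)) ^ 2 := by gcongr; exact hb z (le_of_lt hz)
    _ = _ := by rw [mul_pow, ← Real.exp_nat_mul]; congr 2; push_cast; ring

lemma continuous_cexp_mul (μ : ℂ) : Continuous fun z : ℝ => Complex.exp (μ * z) := by fun_prop

lemma norm_cexp_mul (μ : ℂ) (z : ℝ) : ‖Complex.exp (μ * z)‖ = Real.exp (μ.re * z) := by
  rw [Complex.norm_exp]; simp

lemma memLp_two_cexp {μ : ℂ} (hμ : 0 < μ.re) :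
    MemLp (fun z : ℝ => Complex.exp (-μ * z)) 2 (volume.restrict (Ioi 0)) := by
  refine memLp_two_of_norm_le_exp hμ (continuous_cexp_mul _).continuousOn (C := 1) fun z _ => ?_
  rw [norm_cexp_mul, one_mul, Complex.neg_re]

lemma MeasureTheory.MemLp.intervalIntegrable_of_Ioi {g : ℝ → ℂ} (hg : MemLp g 2 (volume.restrict (Ioi 0)))
    {a b : ℝ} (ha : 0 ≤ a) (hb : 0 ≤ b) : IntervalIntegrable g volume a b := by
  rw [intervalIntegrable_iff]
  have h : uIoc a b ⊆ Ioi 0 := fun x hx => lt_of_le_of_lt (le_min ha hb) hx.1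
  have : IsFiniteMeasure (volume.restrict (uIoc a b)) := ⟨by
    rw [Measure.restrict_apply_univ]; simp [uIoc]⟩
  exact (hg.mono_measure (Measure.restrict_mono h le_rfl)).integrable one_le_two

lemma hasDerivAt_cexp_mul (μ : ℂ) (z : ℝ) :
    HasDerivAt (fun z : ℝ => Complex.exp (μ * z)) (μ * Complex.exp (μ * z)) z := by
  have : HasDerivAt (fun z : ℝ => μ * (z : ℂ)) μ z := by
    simpa using! (Complex.ofRealCLM.hasDerivAt (x := z)).const_mul μ
  rw [mul_comm]
  exact this.cexp

/-- The scalar version of `IsHalfLineH2`. -/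
structure IsScalarHalfLineH2 (v v' v'' : ℝ → ℂ) : Prop where
  memLp : MemLp v 2 (volume.restrict (Ioi 0))
  memLp' : MemLp v' 2 (volume.restrict (Ioi 0))
  memLp'' : MemLp v'' 2 (volume.restrict (Ioi 0))
  eq_integral : ∀ z : ℝ, 0 ≤ z → v z = v 0 + ∫ s in (0 : ℝ)..z, v' s
  eq_integral' : ∀ z : ℝ, 0 ≤ z → v' z = v' 0 + ∫ s in (0 : ℝ)..z, v'' s

section Scalar

variable {v v' v'' g : ℝ → ℂ} {μ ν : ℂ}

lemma IsHalfLineH2.scalar {u u' u'' : ℝ → Fin 2 → ℂ} (h : IsHalfLineH2 u u' u'') (i : Fin 2) :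
    IsScalarHalfLineH2 (fun z => u z i) (fun z => u' z i) (fun z => u'' z i) := by
  have key : ∀ w : ℝ → Fin 2 → ℂ, MemLp w 2 (volume.restrict (Ioi 0)) → ∀ z, 0 ≤ z →
      (∫ s in (0 : ℝ)..z, w s) i = ∫ s in (0 : ℝ)..z, w s i := by
    intro w hw z hz
    rw [intervalIntegral.integral_of_le hz, intervalIntegral.integral_of_le hz, eval_integral]
    intro j
    have := (hw.eval j).intervalIntegrable_of_Ioi le_rfl hz
    rwa [intervalIntegrable_iff_integrableOn_Ioc_of_le hz] at this
  refine ⟨h.memLp.eval i, h.memLp'.eval i, h.memLp''.eval i, fun z hz => ?_, fun z hz => ?_⟩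
  · rw [h.eq_integral z hz, Pi.add_apply, key _ h.memLp' z hz]
  · rw [h.eq_integral' z hz, Pi.add_apply, key _ h.memLp'' z hz]

/-- Factor `∂² - μ² = (∂ - μ)(∂ + μ)`: formally, `e^{-μz}(v' + μv)` has derivative `e^{-μz}(v'' -
μ²v)`. The sign of `Re μ` is free, so the case `-μ` is included. -/
lemma IsScalarHalfLineH2.exp_mul_sub (h : IsScalarHalfLineH2 v v' v'') (μ : ℂ) {a b : ℝ}
    (ha : 0 ≤ a) (hab : a ≤ b) :
    Complex.exp (-μ * b) * (v' b + μ * v b) - Complex.exp (-μ * a) * (v' a + μ * v a) =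
      ∫ z in a..b, Complex.exp (-μ * z) * (v'' z - μ ^ 2 * v z) := by
  have hb := ha.trans hab
  have i1 := fun {c} (hc : 0 ≤ c) => h.memLp'.intervalIntegrable_of_Ioi (le_refl (0 : ℝ)) hc
  have i2 := fun {c} (hc : 0 ≤ c) => h.memLp''.intervalIntegrable_of_Ioi (le_refl (0 : ℝ)) hc
  have hW : ∀ z ∈ Icc a b, v' z + μ * v z =
      (v' a + μ * v a) + ∫ s in a..z, (v'' s + μ * v' s) := by
    intro z hz
    have hz0 : 0 ≤ z := ha.trans hz.1
    have j1 := h.memLp'.intervalIntegrable_of_Ioi ha hz0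
    have j2 := h.memLp''.intervalIntegrable_of_Ioi ha hz0
    rw [intervalIntegral.integral_add j2 (j1.const_mul _), intervalIntegral.integral_const_mul,
      h.eq_integral z hz0, h.eq_integral' z hz0, h.eq_integral a ha, h.eq_integral' a ha,
      ← intervalIntegral.integral_add_adjacent_intervals (i1 ha) j1,
      ← intervalIntegral.integral_add_adjacent_intervals (i2 ha) j2]
    ring
  rw [mul_sub_mul_eq_integral_of_eq_integral hab (hasDerivAt_cexp_mul (-μ)) (by fun_prop)
    ((h.memLp''.intervalIntegrable_of_Ioi ha hb).add
      ((h.memLp'.intervalIntegrable_of_Ioi ha hb).const_mul _)) hW]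
  congr 1
  funext z
  ring

lemma IsScalarHalfLineH2.integral_exp_mul_Ioi (h : IsScalarHalfLineH2 v v' v'') (hμ : 0 < μ.re)
    {y : ℝ} (hy : 0 ≤ y) :
    ∫ z in Ioi y, Complex.exp (-μ * z) * (v'' z - μ ^ 2 * v z) =
      -(Complex.exp (-μ * y) * (v' y + μ * v y)) := by
  have hE := memLp_two_cexp hμ
  have hi : IntegrableOn (fun z : ℝ => Complex.exp (-μ * z) * (v'' z - μ ^ 2 * v z)) (Ioi y) :=
    IntegrableOn.mono_set (hE.integrable_mul (h.memLp''.sub (h.memLp.const_mul (μ ^ 2))))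
      (Ioi_subset_Ioi hy)
  have hT : IntegrableOn (fun z : ℝ => Complex.exp (-μ * z) * (v' z + μ * v z)) (Ioi 0) :=
    hE.integrable_mul (h.memLp'.add (h.memLp.const_mul μ))
  have hlim := intervalIntegral_tendsto_integral_Ioi y hi tendsto_id
  have hlim2 : Tendsto (fun z : ℝ => Complex.exp (-μ * z) * (v' z + μ * v z)) atTop
      (𝓝 ((∫ z in Ioi y, Complex.exp (-μ * z) * (v'' z - μ ^ 2 * v z)) +
        Complex.exp (-μ * y) * (v' y + μ * v y))) := by
    refine (hlim.add_const (Complex.exp (-μ * y) * (v' y + μ * v y))).congr' ?_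
    filter_upwards [eventually_ge_atTop y] with z hz
    rw [id, ← h.exp_mul_sub μ hy hz]
    ring
  -- The boundary term at infinity converges and, as a product of `L²` functions, is integrable; so
  -- its limit is zero.
  have := IntegrableAtFilter.eq_zero_of_tendsto (μ := volume) ⟨Ioi 0, Ioi_mem_atTop _, hT⟩
    (fun s hs => by
      obtain ⟨c, hc⟩ := mem_atTop_sets.1 hs
      rw [← top_le_iff, ← Real.volume_Ici (a := c)]
      exact measure_mono hc) hlim2
  linear_combination this

lemma IsScalarHalfLineH2.integral_exp_mul (h : IsScalarHalfLineH2 v v' v'') (hμ : 0 < μ.re)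
    (hg : ∀ᵐ z ∂(volume.restrict (Ioi (0 : ℝ))), g z = -ν * (v'' z - μ ^ 2 * v z))
    {y : ℝ} (hy : 0 ≤ y) :
    ∫ z in Ioi y, Complex.exp (-μ * z) * g z = ν * Complex.exp (-μ * y) * (v' y + μ * v y) := by
  have h1 := h.integral_exp_mul_Ioi hμ hy
  have h2 : ∫ z in Ioi y, Complex.exp (-μ * z) * g z =
      ∫ z in Ioi y, -ν * (Complex.exp (-μ * z) * (v'' z - μ ^ 2 * v z)) := by
    refine integral_congr_ae ?_
    filter_upwards [ae_mono (Measure.restrict_mono (Ioi_subset_Ioi hy) le_rfl) hg] with z hz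
    rw [hz]; ring
  rw [h2, integral_const_mul, h1]
  ring

lemma IsScalarHalfLineH2.integral_exp_mul_interval (h : IsScalarHalfLineH2 v v' v'')
    (hg : ∀ᵐ z ∂(volume.restrict (Ioi (0 : ℝ))), g z = -ν * (v'' z - μ ^ 2 * v z))
    {y : ℝ} (hy : 0 ≤ y) :
    ∫ z in (0 : ℝ)..y, Complex.exp (μ * z) * g z =
      -ν * (Complex.exp (μ * y) * (v' y - μ * v y) - (v' 0 - μ * v 0)) := by
  have h1 := h.exp_mul_sub (-μ) le_rfl hy
  simp only [neg_neg, Complex.ofReal_zero, mul_zero, Complex.exp_zero, one_mul, neg_sq] at h1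
  have h2 : ∫ z in (0 : ℝ)..y, Complex.exp (μ * z) * g z =
      ∫ z in (0 : ℝ)..y, -ν * (Complex.exp (μ * z) * (v'' z - μ ^ 2 * v z)) := by
    rw [intervalIntegral.integral_of_le hy, intervalIntegral.integral_of_le hy]
    refine integral_congr_ae ?_
    filter_upwards [ae_mono (Measure.restrict_mono Ioc_subset_Ioi_self le_rfl) hg] with z hz
    rw [hz]; ring
  rw [h2, intervalIntegral.integral_const_mul, ← h1]
  ring

/-- Splitting at `y`, the two boundary terms at `y` add up to `2νμ v(y)`: this is the jump of the
whole-line Green function. The boundary term at `0` is left for the reflected exponential and the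
`P` term to correct. -/
lemma IsScalarHalfLineH2.integral_exp_abs_mul (h : IsScalarHalfLineH2 v v' v'') (hμ : 0 < μ.re)
    (hgL : MemLp g 2 (volume.restrict (Ioi 0)))
    (hg : ∀ᵐ z ∂(volume.restrict (Ioi (0 : ℝ))), g z = -ν * (v'' z - μ ^ 2 * v z)) {y : ℝ} (hy : 0 ≤ y) :
    ∫ z in Ioi (0 : ℝ), Complex.exp (-μ * (|y - z| : ℝ)) * g z =
      2 * ν * μ * v y + ν * Complex.exp (-μ * y) * (v' 0 - μ * v 0) := by
  have hi1 : IntervalIntegrable (fun z : ℝ => Complex.exp (-μ * (|y - z| : ℝ)) * g z)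
      volume 0 y :=
    (hgL.intervalIntegrable_of_Ioi le_rfl hy).continuousOn_mul (by fun_prop)
  have e2 : EqOn (fun z : ℝ => Complex.exp (-μ * (|y - z| : ℝ)) * g z)
      (fun z : ℝ => Complex.exp (μ * y) * (Complex.exp (-μ * z) * g z)) (Ioi y) := fun z hz => by
    have hz' : y < z := hz
    simp only [abs_of_neg (sub_neg.2 hz'), ← mul_assoc, ← Complex.exp_add]
    push_cast
    ring_nf
  have hi2 : IntegrableOn (fun z : ℝ => Complex.exp (-μ * (|y - z| : ℝ)) * g z) (Ioi y) := by
    refine IntegrableOn.congr_fun ?_ e2.symm measurableSet_Ioi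
    exact (IntegrableOn.mono_set ((memLp_two_cexp hμ).integrable_mul hgL)
      (Ioi_subset_Ioi hy)).const_mul _
  rw [← intervalIntegral.integral_interval_add_Ioi' hi1 hi2, setIntegral_congr_fun measurableSet_Ioi e2,
    integral_const_mul, h.integral_exp_mul hμ hg hy]
  have e1 : ∫ z in (0 : ℝ)..y, Complex.exp (-μ * (|y - z| : ℝ)) * g z =
      ∫ z in (0 : ℝ)..y, Complex.exp (-μ * y) * (Complex.exp (μ * z) * g z) := by
    refine intervalIntegral.integral_congr fun z hz => ?_
    rw [uIcc_of_le hy] at hz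
    simp only [abs_of_nonneg (sub_nonneg.2 hz.2), ← mul_assoc, ← Complex.exp_add]
    push_cast
    ring_nf
  rw [e1, intervalIntegral.integral_const_mul, h.integral_exp_mul_interval hg hy]
  have e3 : Complex.exp (-μ * y) * Complex.exp (μ * y) = 1 := by
    rw [← Complex.exp_add]; simp
  linear_combination (2 * ν * μ * v y) * e3

end Scalar

/-! ### The explicit kernel represents the resolvent -/

/-- The explicit resolvent kernel. -/
def resolventFormula (ν : ℝ) (ξ : EuclideanSpace ℝ (Fin 2)) (lam : ℂ) (y z : ℝ) :
    Matrix (Fin 2) (Fin 2) ℂ :=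
  ((2 * ν * muRoot ν ξ lam)⁻¹ * (Complex.exp (-muRoot ν ξ lam * (|y - z| : ℝ)) +
      Complex.exp (-muRoot ν ξ lam * (y + z : ℝ)))) • (1 : Matrix (Fin 2) (Fin 2) ℂ) +
    ((muRoot ν ξ lam + ‖ξ‖) / (muRoot ν ξ lam * lam * ‖ξ‖) *
      Complex.exp (-muRoot ν ξ lam * (y + z : ℝ))) • perpMatrix ξ

lemma sum_sq_eq_norm_sq (ξ : EuclideanSpace ℝ (Fin 2)) :
    (ξ 0 : ℂ) ^ 2 + (ξ 1 : ℂ) ^ 2 = (‖ξ‖ : ℂ) ^ 2 := by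
  rw [← Complex.ofReal_pow ‖ξ‖, EuclideanSpace.norm_sq_eq]
  simp

/-- Because `P = |ξ|² I - ξ ξᵀ`, the condition is Neumann along `ξ` and Robin with coefficient `|ξ|`
on `ξ^⊥`. -/
lemma MixedBoundaryCondition.add_perpMatrix {ξ : EuclideanSpace ℝ (Fin 2)} (hξ : ξ ≠ 0)
    {a b : Fin 2 → ℂ} :
    MixedBoundaryCondition ξ a b ↔ ∀ i, b i + (‖ξ‖ : ℂ)⁻¹ * ∑ j, perpMatrix ξ i j * a j = 0 := by
  have hξ' : (‖ξ‖ : ℂ) ≠ 0 := Complex.ofReal_ne_zero.2 (norm_ne_zero_iff.2 hξ)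
  have hs := sum_sq_eq_norm_sq ξ
  refine forall_congr' fun i => ?_
  have key : -(b i + (‖ξ‖ : ℂ) * a i) + (ξ i : ℂ) * (‖ξ‖ : ℂ)⁻¹ * ∑ k, (ξ k : ℂ) * a k =
      -(b i + (‖ξ‖ : ℂ)⁻¹ * ∑ j, perpMatrix ξ i j * a j) := by
    fin_cases i <;> simp [perpMatrix, Fin.sum_univ_two] <;> field_simp
    · linear_combination a 0 * hs
    · linear_combination a 1 * hs
  rw [key, neg_eq_zero]

/-- `P` is `|ξ|²` times the orthogonal projection onto `ξ^⊥`. -/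
lemma perpMatrix_mulVec_mulVec (ξ : EuclideanSpace ℝ (Fin 2)) (e : Fin 2 → ℂ) :
    perpMatrix ξ *ᵥ (perpMatrix ξ *ᵥ e) = ((‖ξ‖ : ℂ) ^ 2) • (perpMatrix ξ *ᵥ e) := by
  have hs := sum_sq_eq_norm_sq ξ
  rw [← hs]
  funext i
  fin_cases i <;> simp [perpMatrix, Matrix.mulVec, dotProduct, Fin.sum_univ_two] <;> ring

section Kernel

variable {ν : ℝ} {ξ : EuclideanSpace ℝ (Fin 2)} {lam : ℂ} {y : ℝ}

lemma continuous_resolventFormula (ν : ℝ) (ξ : EuclideanSpace ℝ (Fin 2)) (lam : ℂ) (y : ℝ) :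
    Continuous (resolventFormula ν ξ lam y) := by
  unfold resolventFormula
  fun_prop

lemma norm_exp_abs_le {μ : ℂ} (hμ : 0 < μ.re) (y z : ℝ) :
    ‖Complex.exp (-μ * (|y - z| : ℝ))‖ ≤ Real.exp (μ.re * y) * Real.exp (-μ.re * z) := by
  rw [norm_cexp_mul, ← Real.exp_add]
  apply Real.exp_le_exp.2
  have := neg_abs_le (y - z)
  simp only [Complex.neg_re]
  nlinarith

lemma memLp_exp_abs {μ : ℂ} (hμ : 0 < μ.re) (y : ℝ) :
    MemLp (fun z : ℝ => Complex.exp (-μ * (|y - z| : ℝ))) 2 (volume.restrict (Ioi 0)) :=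
  memLp_two_of_norm_le_exp hμ (by fun_prop) fun z _ => norm_exp_abs_le hμ y z

lemma memLp_exp_add {μ : ℂ} (hμ : 0 < μ.re) (y : ℝ) :
    MemLp (fun z : ℝ => Complex.exp (-μ * (y + z : ℝ))) 2 (volume.restrict (Ioi 0)) := by
  refine ((memLp_two_cexp hμ).const_mul (Complex.exp (-μ * y))).congr_norm (by fun_prop)
    (.of_forall fun z => ?_)
  rw [← Complex.exp_add]
  push_cast
  ring_nf

lemma memLp_resolventFormula (hν : 0 < ν) (h : lam + (‖ξ‖ : ℂ) ^ 2 * (ν : ℂ) ∈ Complex.slitPlane)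
    (y : ℝ) (i j : Fin 2) :
    MemLp (fun z => resolventFormula ν ξ lam y z i j) 2 (volume.restrict (Ioi 0)) := by
  have hμ := re_muRoot_pos hν h
  set μ := muRoot ν ξ lam with hμd
  convert (((memLp_exp_abs hμ y).add (memLp_exp_add hμ y)).const_mul
    ((2 * ν * μ)⁻¹ * (1 : Matrix (Fin 2) (Fin 2) ℂ) i j)).add ((memLp_exp_add hμ y).const_mul
    ((μ + ‖ξ‖) / (μ * lam * ‖ξ‖) * perpMatrix ξ i j)) using 1
  funext z
  simp only [resolventFormula, Matrix.add_apply, Matrix.smul_apply, smul_eq_mul, Pi.add_apply]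
  ring

/-- The diagonal part returns `u(y) + e^{-μy} u'(0)/μ`, and the remaining part is a multiple of `P
(u'(0) + μ u(0))`. The boundary condition makes the latter a multiple of `u'(0)`, with the
coefficient that cancels the error. -/
lemma resolventFormula_duality (hν : 0 < ν) (hξ : ξ ≠ 0) (hlam : lam ≠ 0)
    (h : lam + (‖ξ‖ : ℂ) ^ 2 * (ν : ℂ) ∈ Complex.slitPlane) (hy : 0 ≤ y) {f u : ℝ → Fin 2 → ℂ}
    (hf : MemLp f 2 (volume.restrict (Ioi 0))) (hu : IsResolventSolution ν ξ lam f u) :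
    u y = ∫ z in Ioi (0 : ℝ), resolventFormula ν ξ lam y z *ᵥ f z := by
  obtain ⟨u', u'', hH, hbc, hae⟩ := hu
  have hμ := re_muRoot_pos hν h
  have hμ0 := muRoot_ne_zero hν h
  have hμa := sub_ne_zero.2 (muRoot_ne_norm (ξ := ξ) hν hlam)
  have hlam2 := eq_mul_muRoot (ξ := ξ) (lam := lam) hν
  have hsq := muRoot_sq (ξ := ξ) (lam := lam) hν
  have hν' : (ν : ℂ) ≠ 0 := Complex.ofReal_ne_zero.2 hν.ne'
  have hξ' : (‖ξ‖ : ℂ) ≠ 0 := Complex.ofReal_ne_zero.2 (norm_ne_zero_iff.2 hξ)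
  rw [MixedBoundaryCondition.add_perpMatrix hξ] at hbc
  set μ := muRoot ν ξ lam with hμd
  set a : ℂ := (‖ξ‖ : ℂ) with ha
  have hg : ∀ j, ∀ᵐ z ∂(volume.restrict (Ioi (0 : ℝ))),
      f z j = -ν * (u'' z j - μ ^ 2 * u z j) := fun j => by
    filter_upwards [hae] with z hz
    rw [← hz]
    simp only [Pi.sub_apply, Pi.smul_apply, smul_eq_mul]
    linear_combination -u z j * hsq
  have hfj : ∀ j, MemLp (fun z => f z j) 2 (volume.restrict (Ioi 0)) := fun j => hf.eval j
  have hA : ∀ j, IntegrableOn (fun z : ℝ => Complex.exp (-μ * (|y - z| : ℝ)) * f z j) (Ioi 0) :=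
    fun j => (memLp_exp_abs hμ y).integrable_mul (hfj j)
  have hB : ∀ j, IntegrableOn (fun z : ℝ => Complex.exp (-μ * (y + z : ℝ)) * f z j) (Ioi 0) :=
    fun j => (memLp_exp_add hμ y).integrable_mul (hfj j)
  have hAv : ∀ j, ∫ z in Ioi (0 : ℝ), Complex.exp (-μ * (|y - z| : ℝ)) * f z j =
      2 * ν * μ * u y j + ν * Complex.exp (-μ * y) * (u' 0 j - μ * u 0 j) := fun j =>
    (hH.scalar j).integral_exp_abs_mul hμ (hfj j) (hg j) hy
  have hBv : ∀ j, ∫ z in Ioi (0 : ℝ), Complex.exp (-μ * (y + z : ℝ)) * f z j =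
      ν * Complex.exp (-μ * y) * (u' 0 j + μ * u 0 j) := fun j => by
    have h1 := (hH.scalar j).integral_exp_mul hμ (hg j) le_rfl
    simp only [Complex.ofReal_zero, mul_zero, Complex.exp_zero, mul_one] at h1
    rw [mul_right_comm, ← h1, mul_comm, ← integral_const_mul]
    congr 1
    funext z
    rw [← mul_assoc, ← Complex.exp_add]
    push_cast
    ring_nf
  have hint : ∀ i j, IntegrableOn (fun z => resolventFormula ν ξ lam y z i j * f z j) (Ioi 0) :=
    fun i j => (memLp_resolventFormula hν h y i j).integrable_mul (hfj j)
  have hterm : ∀ i j, ∫ z in Ioi (0 : ℝ), resolventFormula ν ξ lam y z i j * f z j =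
      (1 : Matrix (Fin 2) (Fin 2) ℂ) i j * (u y j + Complex.exp (-μ * y) * u' 0 j / μ) +
      (μ + a) / (μ * lam * a) * perpMatrix ξ i j *
        (ν * Complex.exp (-μ * y) * (u' 0 j + μ * u 0 j)) := by
    intro i j
    have e : ∀ z, resolventFormula ν ξ lam y z i j * f z j =
        (1 : Matrix (Fin 2) (Fin 2) ℂ) i j * (2 * ν * μ)⁻¹ *
          (Complex.exp (-μ * (|y - z| : ℝ)) * f z j) +
        ((1 : Matrix (Fin 2) (Fin 2) ℂ) i j * (2 * ν * μ)⁻¹ +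
          (μ + a) / (μ * lam * a) * perpMatrix ξ i j) *
          (Complex.exp (-μ * (y + z : ℝ)) * f z j) := fun z => by
      simp only [resolventFormula, Matrix.add_apply, Matrix.smul_apply, smul_eq_mul]
      ring
    simp_rw [e]
    rw [integral_add ((hA j).const_mul _) ((hB j).const_mul _), integral_const_mul,
      integral_const_mul, hAv, hBv]
    field_simp
    ring
  have hμa' : μ + a ≠ 0 := by
    intro h0
    rw [h0, mul_zero, mul_zero] at hlam2
    exact hlam hlam2
  have hρ : (μ + a) / (μ * lam * a) * ν = 1 / (μ * a * (μ - a)) := by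
    field_simp
    linear_combination -hlam2
  have hs : (ξ 0 : ℂ) ^ 2 + (ξ 1 : ℂ) ^ 2 = a ^ 2 := sum_sq_eq_norm_sq ξ
  have hb : ∀ i, a * u' 0 i + ∑ j, perpMatrix ξ i j * u 0 j = 0 := fun i => by
    rw [← mul_zero a, ← hbc i, mul_add, mul_inv_cancel_left₀ hξ']
  -- From `P u(0) = -a u'(0)` and `P² = a² P` one gets `P u'(0) = a² u'(0)`, hence the value `(a² -
  -- aμ) u'(0)`.
  have hP : ∀ i, ∑ j, perpMatrix ξ i j * (u' 0 j + μ * u 0 j) = -(a * (μ - a)) * u' 0 i := by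
    have h0 := hb 0
    have h1 := hb 1
    intro i
    fin_cases i
    all_goals
      simp only [perpMatrix, Fin.sum_univ_two, Matrix.of_apply, Matrix.cons_val_zero,
        Matrix.cons_val_one, Fin.zero_eta, Fin.mk_one, Fin.isValue] at h0 h1 ⊢
      apply mul_left_cancel₀ hξ'
    · linear_combination (a * μ - a ^ 2 + ξ 1 ^ 2) * h0 - ξ 0 * ξ 1 * h1 -
        (ξ 1 ^ 2 * u 0 0 - ξ 0 * ξ 1 * u 0 1) * hs
    · linear_combination (a * μ - a ^ 2 + ξ 0 ^ 2) * h1 - ξ 0 * ξ 1 * h0 -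
        (ξ 0 ^ 2 * u 0 1 - ξ 0 * ξ 1 * u 0 0) * hs
  funext i
  rw [eval_integral]
  · simp_rw [Matrix.mulVec, dotProduct, Fin.sum_univ_two]
    rw [integral_add (hint i 0) (hint i 1), hterm, hterm]
    have hPi := hP i
    rw [Fin.sum_univ_two] at hPi
    have h1 : ∀ c : Fin 2 → ℂ, (1 : Matrix (Fin 2) (Fin 2) ℂ) i 0 * c 0 +
        (1 : Matrix (Fin 2) (Fin 2) ℂ) i 1 * c 1 = c i := fun c => by
      have := congrFun (Matrix.one_mulVec c) i
      rwa [Matrix.mulVec, dotProduct, Fin.sum_univ_two] at this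
    have h2 := h1 fun j => u y j + Complex.exp (-μ * y) * u' 0 j / μ
    have h3 : Complex.exp (-μ * y) * u' 0 i / μ +
        (μ + a) / (μ * lam * a) * ν * Complex.exp (-μ * y) * (-(a * (μ - a)) * u' 0 i) = 0 := by
      rw [hρ]
      field_simp
      ring
    linear_combination -h2 - h3 - (μ + a) / (μ * lam * a) * ν * Complex.exp (-μ * y) * hPi
  · intro i
    simp_rw [Matrix.mulVec, dotProduct, Fin.sum_univ_two]
    exact (hint i 0).add (hint i 1)

lemma isResolventOfDelta_resolventFormula (hν : 0 < ν) (hξ : ξ ≠ 0) (hlam : lam ≠ 0)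
    (h : lam + (‖ξ‖ : ℂ) ^ 2 * (ν : ℂ) ∈ Complex.slitPlane) (hy : 0 ≤ y) :
    IsResolventOfDelta ν ξ lam y (resolventFormula ν ξ lam y) where
  continuousOn := (continuous_resolventFormula ν ξ lam y).continuousOn
  memLp := memLp_resolventFormula hν h y
  duality _ _ hf hu := resolventFormula_duality hν hξ hlam h hy hf hu

end Kernel

/-! ### Solvability for test functions and uniqueness of the kernel -/

lemma memLp_two_of_eq_exp {f : ℝ → ℂ} {μ c : ℂ} {M : ℝ} (hμ : 0 < μ.re) (hf : Continuous f)
    (hfM : ∀ z, M ≤ z → f z = c * Complex.exp (-μ * z)) : MemLp f 2 (volume.restrict (Ioi 0)) := by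
  obtain ⟨C, hC⟩ := (isCompact_Icc (a := 0) (b := M)).exists_bound_of_continuousOn hf.continuousOn
  refine memLp_two_of_norm_le_exp hμ hf.continuousOn
    (C := max ‖c‖ (|C| * Real.exp (μ.re * M))) fun z hz => ?_
  rcases le_total M z with h | h
  · rw [hfM z h, norm_mul, norm_cexp_mul, Complex.neg_re]
    gcongr
    exact le_max_left _ _
  · calc ‖f z‖ ≤ |C| * Real.exp 0 := by
          rw [Real.exp_zero, mul_one]
          exact (hC z ⟨hz, h⟩).trans (le_abs_self C)
      _ ≤ |C| * Real.exp (μ.re * M + -μ.re * z) := by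
          gcongr
          nlinarith
      _ = (|C| * Real.exp (μ.re * M)) * Real.exp (-μ.re * z) := by rw [Real.exp_add]; ring
      _ ≤ _ := by
          gcongr
          exact le_max_right _ _

lemma integral_eq_of_eq_zero_of_le {ψ : ℝ → ℂ} (hψ : Continuous ψ) {M z : ℝ} (hz : M ≤ z)
    (hM : ∀ s, M ≤ s → ψ s = 0) : ∫ s in (0 : ℝ)..z, ψ s = ∫ s in (0 : ℝ)..M, ψ s := by
  have h0 : ∫ s in M..z, ψ s = ∫ _ in M..z, (0 : ℂ) :=
    intervalIntegral.integral_congr fun s hs => by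
      rw [uIcc_of_le hz] at hs
      exact hM s hs.1
  rw [← intervalIntegral.integral_add_adjacent_intervals (hψ.intervalIntegrable 0 M)
    (hψ.intervalIntegrable M z), h0, intervalIntegral.integral_zero, add_zero]

/-- The decaying solution of `v'' = μ² v - φ / ν` with `v' = μ v` at `0`. -/
lemma exists_scalar_solution {ν μ : ℂ} (hν : ν ≠ 0) (hμ : 0 < μ.re) {φ : ℝ → ℂ}
    (hφ : Continuous φ) {M : ℝ} (hM : ∀ z, M ≤ z → φ z = 0) :
    ∃ v v' : ℝ → ℂ, (∀ z, HasDerivAt v (v' z) z) ∧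
      (∀ z, HasDerivAt v' (μ ^ 2 * v z - φ z / ν) z) ∧ v' 0 = μ * v 0 ∧
      MemLp v 2 (volume.restrict (Ioi 0)) ∧ MemLp v' 2 (volume.restrict (Ioi 0)) := by
  have hμ0 : μ ≠ 0 := fun h => by simp [h] at hμ
  have hcA : Continuous fun s : ℝ => Complex.exp (μ * s) * φ s := by fun_prop
  have hcB : Continuous fun s : ℝ => Complex.exp (-μ * s) * φ s := by fun_prop
  set A : ℝ → ℂ := fun z => ∫ s in (0 : ℝ)..z, Complex.exp (μ * s) * φ s with hA
  set B : ℝ → ℂ := fun z => ∫ s in (0 : ℝ)..z, Complex.exp (-μ * s) * φ s with hB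
  have dA : ∀ z : ℝ, HasDerivAt A (Complex.exp (μ * z) * φ z) z := fun z =>
    intervalIntegral.integral_hasDerivAt_right (hcA.intervalIntegrable _ _)
      hcA.aestronglyMeasurable.stronglyMeasurableAtFilter hcA.continuousAt
  have dB : ∀ z : ℝ, HasDerivAt B (Complex.exp (-μ * z) * φ z) z := fun z =>
    intervalIntegral.integral_hasDerivAt_right (hcB.intervalIntegrable _ _)
      hcB.aestronglyMeasurable.stronglyMeasurableAtFilter hcB.continuousAt
  have eA : ∀ z, M ≤ z → A z = A M := fun z hz =>
    integral_eq_of_eq_zero_of_le hcA hz fun s hs => by simp [hM s hs]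
  have eB : ∀ z, M ≤ z → B z = B M := fun z hz =>
    integral_eq_of_eq_zero_of_le hcB hz fun s hs => by simp [hM s hs]
  have hE : ∀ z : ℝ, Complex.exp (-μ * z) * Complex.exp (μ * z) = 1 := fun z => by
    rw [← Complex.exp_add]; simp
  -- Variation of constants. Since `φ` vanishes beyond `M`, the constant `B M` plays the role of the
  -- integral to infinity: it removes the growing exponential for `z ≥ M`. At `0` only this
  -- exponential is present, as `A 0 = 0`, whence `v' = μ v` there.
  set v : ℝ → ℂ := fun z => (2 * ν * μ)⁻¹ *
    (Complex.exp (-μ * z) * A z + Complex.exp (μ * z) * (B M - B z)) with hv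
  set v' : ℝ → ℂ := fun z => (2 * ν)⁻¹ *
    (-(Complex.exp (-μ * z) * A z) + Complex.exp (μ * z) * (B M - B z)) with hv'
  have dv : ∀ z, HasDerivAt v (v' z) z := fun z => by
    convert! (((hasDerivAt_cexp_mul (-μ) z).mul (dA z)).add
      ((hasDerivAt_cexp_mul μ z).mul ((dB z).const_sub (B M)))).const_mul (2 * ν * μ)⁻¹ using 1
    simp only [hv']
    field_simp
    ring
  have dv' : ∀ z, HasDerivAt v' (μ ^ 2 * v z - φ z / ν) z := fun z => by
    convert! (((hasDerivAt_cexp_mul (-μ) z).mul (dA z)).neg.add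
      ((hasDerivAt_cexp_mul μ z).mul ((dB z).const_sub (B M)))).const_mul (2 * ν)⁻¹ using 1
    simp only [hv]
    field_simp
    have hEz := hE z
    rw [neg_mul] at hEz
    linear_combination (2 * φ z) * hEz
  refine ⟨v, v', dv, dv', ?_, ?_, ?_⟩
  · simp only [hv, hv', hA, hB, Complex.ofReal_zero, mul_zero, Complex.exp_zero,
      intervalIntegral.integral_same]
    field_simp
    ring
  · refine memLp_two_of_eq_exp (c := (2 * ν * μ)⁻¹ * A M) (M := M) hμ
      (continuous_iff_continuousAt.2 fun z => (dv z).continuousAt) fun z hz => ?_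
    simp only [hv, eA z hz, eB z hz]
    ring
  · refine memLp_two_of_eq_exp (c := -(2 * ν)⁻¹ * A M) (M := M) hμ
      (continuous_iff_continuousAt.2 fun z => (dv' z).continuousAt) fun z hz => ?_
    simp only [hv', eA z hz, eB z hz]
    ring

lemma eq_integral_of_hasDerivAt {u u' : ℝ → Fin 2 → ℂ} (h : ∀ z, HasDerivAt u (u' z) z)
    (hc : Continuous u') (z : ℝ) : u z = u 0 + ∫ s in (0 : ℝ)..z, u' s := by
  rw [intervalIntegral.integral_eq_sub_of_hasDerivAt (fun s _ => h s)
    (hc.intervalIntegrable _ _)]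
  abel

section Uniqueness

variable {ν : ℝ} {ξ : EuclideanSpace ℝ (Fin 2)} {lam : ℂ} {y : ℝ}

lemma exists_isResolventSolution (hν : 0 < ν) (hξ : ξ ≠ 0) (hlam : lam ≠ 0)
    (h : lam + (‖ξ‖ : ℂ) ^ 2 * (ν : ℂ) ∈ Complex.slitPlane) {φ : ℝ → ℂ} (hφ : Continuous φ)
    {M : ℝ} (hM : ∀ z, M ≤ z → φ z = 0) (e : Fin 2 → ℂ) :
    ∃ u, IsResolventSolution ν ξ lam (fun z => φ z • e) u := by
  have hμ := re_muRoot_pos hν h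
  have hμ0 := muRoot_ne_zero hν h
  have hμa := sub_ne_zero.2 (muRoot_ne_norm (ξ := ξ) hν hlam)
  have hsq := muRoot_sq (ξ := ξ) (lam := lam) hν
  have hν' : (ν : ℂ) ≠ 0 := Complex.ofReal_ne_zero.2 hν.ne'
  have hξ' : (‖ξ‖ : ℂ) ≠ 0 := Complex.ofReal_ne_zero.2 (norm_ne_zero_iff.2 hξ)
  have hs := sum_sq_eq_norm_sq ξ
  set μ := muRoot ν ξ lam with hμd
  set a : ℂ := (‖ξ‖ : ℂ) with ha
  obtain ⟨v, v', dv, dv', hv0, mv, mv'⟩ := exists_scalar_solution hν' hμ hφ hM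
  have cv : Continuous v := continuous_iff_continuousAt.2 fun z => (dv z).continuousAt
  have cv' : Continuous v' := continuous_iff_continuousAt.2 fun z => (dv' z).continuousAt
  have mφ : MemLp φ 2 (volume.restrict (Ioi 0)) :=
    memLp_two_of_eq_exp (c := 0) (M := M) hμ hφ fun z hz => by simp [hM z hz]
  have mE := memLp_two_cexp hμ
  -- Amplitude of the decaying homogeneous solution that restores the boundary condition. With `d =
  -- v(0)(e + c P e)`, `v'(0) = μ v(0)` and `P² = a² P`, the condition becomes `-μc + 2/a + ac = 0`;
  -- `μ ≠ a` because `λ ≠ 0`.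
  set d : Fin 2 → ℂ := v 0 • (e + (2 / (a * (μ - a))) • (perpMatrix ξ *ᵥ e)) with hd
  refine ⟨fun z => v z • e + Complex.exp (-μ * z) • d,
    fun z => v' z • e + (-μ * Complex.exp (-μ * z)) • d,
    fun z => (μ ^ 2 * v z - φ z / ν) • e + (-μ * (-μ * Complex.exp (-μ * z))) • d,
    ⟨?_, ?_, ?_, ?_, ?_⟩, ?_, ?_⟩
  · refine MemLp.of_eval fun i => ?_
    exact (mv.mul_const (e i)).add (mE.mul_const (d i))
  · refine MemLp.of_eval fun i => ?_
    exact (mv'.mul_const (e i)).add ((mE.const_mul (-μ)).mul_const (d i))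
  · refine MemLp.of_eval fun i => ?_
    convert (((mv.const_mul (μ ^ 2)).sub (mφ.mul_const (ν : ℂ)⁻¹)).mul_const (e i)).add
      (((mE.const_mul (-μ)).const_mul (-μ)).mul_const (d i)) using 1
    funext x
    simp only [Pi.add_apply, Pi.smul_apply, smul_eq_mul, Pi.sub_apply, div_eq_mul_inv]
  · exact fun z _ => eq_integral_of_hasDerivAt
      (fun z => ((dv z).smul_const e).add ((hasDerivAt_cexp_mul (-μ) z).smul_const d))
      (by fun_prop) z
  · exact fun z _ => eq_integral_of_hasDerivAt
      (fun z => ((dv' z).smul_const e).add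
        (((hasDerivAt_cexp_mul (-μ) z).const_mul (-μ)).smul_const d))
      (by fun_prop) z
  · rw [MixedBoundaryCondition.add_perpMatrix hξ]
    intro i
    have hPP := congrFun (perpMatrix_mulVec_mulVec ξ e) i
    have h1 : ∑ j, perpMatrix ξ i j * (v 0 • e + Complex.exp (-μ * ((0 : ℝ) : ℂ)) • d) j =
        (perpMatrix ξ *ᵥ (v 0 • e + d)) i := by
      simp [Matrix.mulVec, dotProduct]
    rw [h1, hd, Matrix.mulVec_add, Matrix.mulVec_smul, Matrix.mulVec_smul, Matrix.mulVec_add,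
      Matrix.mulVec_smul]
    simp only [Pi.add_apply, Pi.smul_apply, smul_eq_mul, hPP, hv0, Complex.ofReal_zero, mul_zero,
      Complex.exp_zero, ← ha]
    field_simp
    ring
  · refine .of_forall fun z => ?_
    funext i
    simp only [Pi.sub_apply, Pi.smul_apply, Pi.add_apply, smul_eq_mul]
    field_simp
    linear_combination -(v z * e i + Complex.exp (-(μ * z)) * d i) * hsq

/-- Duality only tests right-hand sides for which a solution is given. Solutions exist for every
smooth compactly supported scalar function on `(0, ∞)` times a basis vector, which suffices for
almost everywhere equality of each entry; continuity then extends it to all of `[0, ∞)`. -/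
lemma IsResolventOfDelta.eqOn (hν : 0 < ν) (hξ : ξ ≠ 0) (hlam : lam ≠ 0)
    (h : lam + (‖ξ‖ : ℂ) ^ 2 * (ν : ℂ) ∈ Complex.slitPlane)
    {K₁ K₂ : ℝ → Matrix (Fin 2) (Fin 2) ℂ} (h₁ : IsResolventOfDelta ν ξ lam y K₁)
    (h₂ : IsResolventOfDelta ν ξ lam y K₂) : EqOn K₁ K₂ (Ici 0) := by
  have hc : ∀ {K}, IsResolventOfDelta ν ξ lam y K → ∀ i j, ContinuousOn (fun z => K z i j) (Ici 0) :=
    fun hK i j => (continuous_apply_apply i j).comp_continuousOn hK.continuousOn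
  have key : ∀ i j, EqOn (fun z => K₁ z i j) (fun z => K₂ z i j) (Ioi 0) := by
    intro i j
    have hloc : LocallyIntegrableOn (fun z => K₁ z i j - K₂ z i j) (Ioi 0) :=
      (((hc h₁ i j).sub (hc h₂ i j)).mono Ioi_subset_Ici_self).locallyIntegrableOn
        measurableSet_Ioi
    have hae := isOpen_Ioi.ae_eq_zero_of_integral_contDiff_smul_eq_zero hloc ?_
    · refine Measure.eqOn_open_of_ae_eq (μ := volume) ?_ isOpen_Ioi
        ((hc h₁ i j).mono Ioi_subset_Ici_self) ((hc h₂ i j).mono Ioi_subset_Ici_self)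
      rw [Filter.EventuallyEq, ae_restrict_iff' measurableSet_Ioi]
      filter_upwards [hae] with z hz hz0
      exact sub_eq_zero.1 (hz hz0)
    · intro g hg hgc hgs
      obtain ⟨M, hM⟩ := hgc.isCompact.bddAbove
      have hgM : ∀ z, M + 1 ≤ z → ((g z : ℝ) : ℂ) = 0 := fun z hz => by
        rw [image_eq_zero_of_notMem_tsupport (f := g) fun hmem => ?_, Complex.ofReal_zero]
        have := hM hmem
        linarith
      have hgcont : Continuous fun z => ((g z : ℝ) : ℂ) :=
        Complex.continuous_ofReal.comp hg.continuous
      set e : Fin 2 → ℂ := Pi.single j 1 with he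
      obtain ⟨u, hu⟩ := exists_isResolventSolution hν hξ hlam h hgcont hgM e
      have mg : MemLp (fun z => ((g z : ℝ) : ℂ)) 2 (volume.restrict (Ioi 0)) :=
        memLp_two_of_eq_exp (c := 0) (M := M + 1) (μ := 1) (by simp) hgcont
          fun z hz => by simp [hgM z hz]
      have mf : MemLp (fun z => ((g z : ℝ) : ℂ) • e) 2 (volume.restrict (Ioi 0)) :=
        MemLp.of_eval fun i => mg.mul_const (e i)
      have hmul : ∀ K : Matrix (Fin 2) (Fin 2) ℂ, ∀ z i, (K *ᵥ (((g z : ℝ) : ℂ) • e)) i =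
          K i j * ((g z : ℝ) : ℂ) := fun K z i => by
        rw [Matrix.mulVec_smul, he, Matrix.mulVec_single_one, Pi.smul_apply, smul_eq_mul, mul_comm]
        rfl
      have hval : ∀ {K}, IsResolventOfDelta ν ξ lam y K →
          IntegrableOn (fun z => K z i j * ((g z : ℝ) : ℂ)) (Ioi 0) ∧
          u y i = ∫ z in Ioi (0 : ℝ), K z i j * ((g z : ℝ) : ℂ) := by
        intro K hK
        refine ⟨(hK.memLp i j).integrable_mul mg, ?_⟩
        rw [hK.duality _ u mf hu, eval_integral]
        · simp_rw [hmul]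
        · intro k
          simp_rw [hmul]
          exact (hK.memLp k j).integrable_mul mg
      obtain ⟨i₁, e₁⟩ := hval h₁
      obtain ⟨i₂, e₂⟩ := hval h₂
      have hsupp : ∀ z, z ∉ Ioi (0 : ℝ) → g z • (K₁ z i j - K₂ z i j) = 0 := fun z hz => by
        rw [image_eq_zero_of_notMem_tsupport (f := g) fun hmem => hz (hgs hmem), zero_smul]
      rw [← setIntegral_eq_integral_of_forall_compl_eq_zero hsupp]
      have : ∀ z, g z • (K₁ z i j - K₂ z i j) =
          K₁ z i j * ((g z : ℝ) : ℂ) - K₂ z i j * ((g z : ℝ) : ℂ) := fun z => by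
        rw [Complex.real_smul]; ring
      simp_rw [this]
      rw [integral_sub i₁ i₂, ← e₁, ← e₂, sub_self]
  intro z hz
  ext i j
  exact (key i j).of_subset_closure (hc h₁ i j) (hc h₂ i j) Ioi_subset_Ici_self
    (by rw [closure_Ioi]) hz

lemma isResolventOfDelta_resolventKernel (hν : 0 < ν) (hξ : ξ ≠ 0) (hlam : lam ≠ 0)
    (h : lam + (‖ξ‖ : ℂ) ^ 2 * (ν : ℂ) ∈ Complex.slitPlane) (hy : 0 ≤ y) :
    IsResolventOfDelta ν ξ lam y (resolventKernel ν ξ lam y) := by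
  have hex : ∃ K, IsResolventOfDelta ν ξ lam y K :=
    ⟨_, isResolventOfDelta_resolventFormula hν hξ hlam h hy⟩
  rw [resolventKernel, dif_pos hex]
  exact hex.choose_spec

lemma resolventKernel_eq (hν : 0 < ν) (hξ : ξ ≠ 0) (hlam : lam ≠ 0)
    (h : lam + (‖ξ‖ : ℂ) ^ 2 * (ν : ℂ) ∈ Complex.slitPlane) (hy : 0 ≤ y) {z : ℝ} (hz : 0 ≤ z) :
    resolventKernel ν ξ lam y z = resolventFormula ν ξ lam y z :=
  (isResolventOfDelta_resolventKernel hν hξ hlam h hy).eqOn hν hξ hlam h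
    (isResolventOfDelta_resolventFormula hν hξ hlam h hy) hz

end Uniqueness

/-! ### Decomposition of the Green function -/

lemma dampedHeat_neg (ν a t r : ℝ) : dampedHeat ν a t (-r) = dampedHeat ν a t r := by
  simp [dampedHeat]

lemma dampedHeat_abs (ν a t r : ℝ) : dampedHeat ν a t |r| = dampedHeat ν a t r := by
  simp [dampedHeat]

/-- The Green function in terms of the heat kernel and of `residualFactor`. -/
def greenFormula (ν : ℝ) (ξ : EuclideanSpace ℝ (Fin 2)) (t y z : ℝ) (i j : Fin 2) : ℂ :=
  (1 : Matrix (Fin 2) (Fin 2) ℂ) i j *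
    (dampedHeat ν ‖ξ‖ t (z - y) + dampedHeat ν ‖ξ‖ t (z + y)) +
  perpMatrix ξ i j * residualFactor ν ‖ξ‖ t (z + y)

section Decomposition

variable {γ : ℝ → ℂ} {F G H : ℂ → ℂ}

lemma IsAdmissiblePath.pathIntegrable_congr (hγ : IsAdmissiblePath γ)
    (h : ∀ lam ∈ Complex.slitPlane, F lam = G lam) :
    PathIntegrable γ F ↔ PathIntegrable γ G := by
  simp only [PathIntegrable, h _ (hγ.mem_slitPlane _)]

lemma IsAdmissiblePath.pathIntegral_congr (hγ : IsAdmissiblePath γ)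
    (h : ∀ lam ∈ Complex.slitPlane, F lam = G lam) : pathIntegral γ F = pathIntegral γ G := by
  simp only [pathIntegral, h _ (hγ.mem_slitPlane _)]

lemma PathIntegrable.add (hF : PathIntegrable γ F) (hG : PathIntegrable γ G) :
    PathIntegrable γ (fun lam => F lam + G lam) := by
  unfold PathIntegrable
  simp only [add_mul]
  exact Integrable.add hF hG

lemma PathIntegrable.const_mul (c : ℂ) (hF : PathIntegrable γ F) :
    PathIntegrable γ (fun lam => c * F lam) := by
  unfold PathIntegrable
  simp only [mul_assoc]
  exact Integrable.const_mul hF c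

lemma pathIntegral_add (hF : PathIntegrable γ F) (hG : PathIntegrable γ G) :
    pathIntegral γ (fun lam => F lam + G lam) = pathIntegral γ F + pathIntegral γ G := by
  unfold pathIntegral
  simp only [add_mul]
  rw [integral_add hF hG, mul_add]

lemma pathIntegral_const_mul (c : ℂ) (F : ℂ → ℂ) :
    pathIntegral γ (fun lam => c * F lam) = c * pathIntegral γ F := by
  unfold pathIntegral
  simp only [mul_assoc]
  rw [integral_const_mul]
  ring

variable {ν : ℝ} {ξ : EuclideanSpace ℝ (Fin 2)} {t y z : ℝ}

lemma residualIntegrand_apply (ν : ℝ) (ξ : EuclideanSpace ℝ (Fin 2)) (t y z : ℝ) (lam : ℂ)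
    (i j : Fin 2) : residualIntegrand ν ξ t y z lam i j =
      perpMatrix ξ i j * (Complex.exp (lam * t) *
        ((muRoot ν ξ lam + (‖ξ‖ : ℂ)) / (muRoot ν ξ lam * lam * (‖ξ‖ : ℂ))) *
        Complex.exp (-muRoot ν ξ lam * (y + z : ℝ))) := by
  rw [residualIntegrand, Matrix.smul_apply, smul_eq_mul, mul_comm]

lemma IsAdmissiblePath.pathIntegrable_residualIntegrand (hγ : IsAdmissiblePath γ) (hν : 0 < ν)
    (hξ : ξ ≠ 0) (ht : 0 < t) (hy : 0 ≤ y) (hz : 0 ≤ z) (i j : Fin 2) :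
    PathIntegrable γ (fun lam => residualIntegrand ν ξ t y z lam i j) := by
  simp only [residualIntegrand_apply]
  exact (hγ.pathIntegral_residual hν hξ ht (add_nonneg hy hz)).1.const_mul _

lemma IsAdmissiblePath.residualKernel_apply (hγ : IsAdmissiblePath γ) (hν : 0 < ν)
    (hξ : ξ ≠ 0) (ht : 0 < t) (hy : 0 ≤ y) (hz : 0 ≤ z) (i j : Fin 2) :
    residualKernel ν ξ γ t y z i j = perpMatrix ξ i j * residualFactor ν ‖ξ‖ t (y + z) := by
  rw [residualKernel, Matrix.of_apply]
  simp only [residualIntegrand_apply]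
  rw [pathIntegral_const_mul, (hγ.pathIntegral_residual hν hξ ht (add_nonneg hy hz)).2]

lemma greenIntegrand_apply (hν : 0 < ν) (hξ : ξ ≠ 0) (t : ℝ) (hy : 0 ≤ y) (hz : 0 ≤ z)
    (i j : Fin 2) (lam : ℂ) (hl : lam ∈ Complex.slitPlane) :
    greenIntegrand ν ξ t y z lam i j =
      (1 : Matrix (Fin 2) (Fin 2) ℂ) i j * (Complex.exp (lam * t) *
        ((2 * ν * muRoot ν ξ lam)⁻¹ * Complex.exp (-muRoot ν ξ lam * (|y - z| : ℝ))) +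
      Complex.exp (lam * t) *
        ((2 * ν * muRoot ν ξ lam)⁻¹ * Complex.exp (-muRoot ν ξ lam * (y + z : ℝ)))) +
      residualIntegrand ν ξ t y z lam i j := by
  rw [greenIntegrand, resolventKernel_eq hν hξ (Complex.slitPlane_ne_zero hl)
    (add_mem_slitPlane hν hl) hy hz, resolventFormula, residualIntegrand_apply]
  simp only [Matrix.add_apply, Matrix.smul_apply, smul_eq_mul]
  ring

lemma IsAdmissiblePath.pathIntegrable_greenIntegrand (hγ : IsAdmissiblePath γ) (hν : 0 < ν)
    (hξ : ξ ≠ 0) (ht : 0 < t) (hy : 0 ≤ y) (hz : 0 ≤ z) (i j : Fin 2) :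
    PathIntegrable γ (fun lam => greenIntegrand ν ξ t y z lam i j) := by
  refine (hγ.pathIntegrable_congr (greenIntegrand_apply hν hξ t hy hz i j)).2 ?_
  exact (((hγ.pathIntegral_heat hν ht (abs_nonneg _)).1.add
    (hγ.pathIntegral_heat hν ht (add_nonneg hy hz)).1).const_mul _).add
    (hγ.pathIntegrable_residualIntegrand hν hξ ht hy hz i j)

lemma neumannHeatKernel_apply (ν : ℝ) (ξ : EuclideanSpace ℝ (Fin 2)) (t y z : ℝ) (i j : Fin 2) :
    neumannHeatKernel ν ξ t y z i j = (1 : Matrix (Fin 2) (Fin 2) ℂ) i j *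
      (dampedHeat ν ‖ξ‖ t (z - y) + dampedHeat ν ‖ξ‖ t (z + y)) := by
  rw [neumannHeatKernel, Matrix.smul_apply, smul_eq_mul, dampedHeat, dampedHeat]
  push_cast
  ring

lemma IsAdmissiblePath.greenKernel_decomposition (hγ : IsAdmissiblePath γ) (hν : 0 < ν)
    (hξ : ξ ≠ 0) (ht : 0 < t) (hy : 0 ≤ y) (hz : 0 ≤ z) :
    greenKernel ν ξ γ t y z = neumannHeatKernel ν ξ t y z + residualKernel ν ξ γ t y z := by
  ext i j
  have h1 := hγ.pathIntegral_heat (ξ := ξ) hν ht (abs_nonneg (y - z))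
  have h2 := hγ.pathIntegral_heat (ξ := ξ) hν ht (add_nonneg hy hz)
  rw [greenKernel, Matrix.of_apply, Matrix.add_apply,
    hγ.pathIntegral_congr (greenIntegrand_apply hν hξ t hy hz i j),
    pathIntegral_add ((h1.1.add h2.1).const_mul _)
      (hγ.pathIntegrable_residualIntegrand hν hξ ht hy hz i j),
    pathIntegral_const_mul, pathIntegral_add h1.1 h2.1, h1.2, h2.2, neumannHeatKernel_apply,
    dampedHeat_abs, ← neg_sub z y, dampedHeat_neg, add_comm y z]
  rfl

lemma IsAdmissiblePath.greenKernel_apply (hγ : IsAdmissiblePath γ) (hν : 0 < ν)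
    (hξ : ξ ≠ 0) (ht : 0 < t) (hy : 0 ≤ y) (hz : 0 ≤ z) (i j : Fin 2) :
    greenKernel ν ξ γ t y z i j = greenFormula ν ξ t y z i j := by
  rw [hγ.greenKernel_decomposition hν hξ ht hy hz, Matrix.add_apply, neumannHeatKernel_apply,
    hγ.residualKernel_apply hν hξ ht hy hz, greenFormula, add_comm y z]

end Decomposition

/-! ### Heat equation and boundary condition -/

section Regularity

variable {ν : ℝ} {ξ : EuclideanSpace ℝ (Fin 2)} {t : ℝ}

lemma contDiff_greenFormula (hν : 0 < ν) (hξ : ξ ≠ 0) (ht : 0 < t) (y : ℝ) (i j : Fin 2) :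
    ContDiff ℝ 2 (fun z => greenFormula ν ξ t y z i j) := by
  have h1 : ContDiff ℝ 2 fun r => (dampedHeat ν ‖ξ‖ t r : ℂ) :=
    Complex.ofRealCLM.contDiff.comp (contDiff_dampedHeat ν ‖ξ‖ t)
  have h2 := contDiff_residualFactor hν (norm_pos_iff.2 hξ) ht 2
  unfold greenFormula
  exact (contDiff_const.mul ((h1.comp (contDiff_id.sub contDiff_const)).add
    (h1.comp (contDiff_id.add contDiff_const)))).add
    (contDiff_const.mul (h2.comp (contDiff_id.add contDiff_const)))

lemma hasDerivAt_greenFormula (hν : 0 < ν) (hξ : ξ ≠ 0) (ht : 0 < t) (y z : ℝ) (i j : Fin 2) :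
    HasDerivAt (fun z => greenFormula ν ξ t y z i j)
      ((1 : Matrix (Fin 2) (Fin 2) ℂ) i j *
        (-((z - y) / (2 * ν * t)) * dampedHeat ν ‖ξ‖ t (z - y) -
          (z + y) / (2 * ν * t) * dampedHeat ν ‖ξ‖ t (z + y)) +
        perpMatrix ξ i j * (-‖ξ‖ * residualFactor ν ‖ξ‖ t (z + y) -
          2 / ‖ξ‖ * dampedHeat ν ‖ξ‖ t (z + y))) z := by
  have h1 := ((hasDerivAt_dampedHeat ν ‖ξ‖ t (z - y)).comp_sub_const z y).ofReal_comp
  have h2 := ((hasDerivAt_dampedHeat ν ‖ξ‖ t (z + y)).comp_add_const z y).ofReal_comp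
  have h3 := (hasDerivAt_residualFactor hν (norm_pos_iff.2 hξ) ht (z + y)).comp_add_const z y
  convert! ((h1.add h2).const_mul ((1 : Matrix (Fin 2) (Fin 2) ℂ) i j)).add
    (h3.const_mul (perpMatrix ξ i j)) using 1
  push_cast
  ring

lemma iteratedDeriv_two_greenFormula (hν : 0 < ν) (hξ : ξ ≠ 0) (ht : 0 < t) (y z : ℝ)
    (i j : Fin 2) : iteratedDeriv 2 (fun z => greenFormula ν ξ t y z i j) z =
      (1 : Matrix (Fin 2) (Fin 2) ℂ) i j *
        ((((z - y) / (2 * ν * t)) ^ 2 - 1 / (2 * ν * t)) * dampedHeat ν ‖ξ‖ t (z - y) +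
          (((z + y) / (2 * ν * t)) ^ 2 - 1 / (2 * ν * t)) * dampedHeat ν ‖ξ‖ t (z + y)) +
        perpMatrix ξ i j * (‖ξ‖ ^ 2 * residualFactor ν ‖ξ‖ t (z + y) +
          (2 + 2 / ‖ξ‖ * ((z + y) / (2 * ν * t))) * dampedHeat ν ‖ξ‖ t (z + y)) := by
  have hξ' : (‖ξ‖ : ℂ) ≠ 0 := Complex.ofReal_ne_zero.2 (norm_ne_zero_iff.2 hξ)
  rw [iteratedDeriv_succ, iteratedDeriv_one]
  have hd : deriv (fun z => greenFormula ν ξ t y z i j) = _ :=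
    funext fun z => (hasDerivAt_greenFormula hν hξ ht y z i j).deriv
  rw [hd]
  have h1 := ((hasDerivAt_dampedHeat ν ‖ξ‖ t (z - y)).comp_sub_const z y).ofReal_comp
  have h2 := ((hasDerivAt_dampedHeat ν ‖ξ‖ t (z + y)).comp_add_const z y).ofReal_comp
  have h3 := (hasDerivAt_residualFactor hν (norm_pos_iff.2 hξ) ht (z + y)).comp_add_const z y
  have l0 : HasDerivAt (fun z : ℝ => (z : ℂ)) 1 z := Complex.ofRealCLM.hasDerivAt (x := z)
  have l1 : HasDerivAt (fun z : ℝ => -(((z : ℂ) - y) / (2 * ν * t))) (-(1 / (2 * ν * t))) z :=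
    ((l0.sub_const (y : ℂ)).div_const _).neg
  have l2 : HasDerivAt (fun z : ℝ => ((z : ℂ) + y) / (2 * ν * t)) (1 / (2 * ν * t)) z :=
    (l0.add_const (y : ℂ)).div_const _
  refine HasDerivAt.deriv ?_
  convert! (((l1.mul h1).sub (l2.mul h2)).const_mul
    ((1 : Matrix (Fin 2) (Fin 2) ℂ) i j)).add (((h3.const_mul (-(‖ξ‖ : ℂ))).sub
    (h2.const_mul (2 / (‖ξ‖ : ℂ)))).const_mul (perpMatrix ξ i j)) using 1
  push_cast
  field_simp
  ring

lemma hasDerivAt_greenFormula_time (hν : 0 < ν) (hξ : ξ ≠ 0) (ht : 0 < t) (y z : ℝ)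
    (i j : Fin 2) : HasDerivAt (fun t => greenFormula ν ξ t y z i j)
      (ν * (iteratedDeriv 2 (fun z => greenFormula ν ξ t y z i j) z -
        (‖ξ‖ : ℂ) ^ 2 * greenFormula ν ξ t y z i j)) t := by
  have hξ' : (‖ξ‖ : ℂ) ≠ 0 := Complex.ofReal_ne_zero.2 (norm_ne_zero_iff.2 hξ)
  have hν' : (ν : ℂ) ≠ 0 := Complex.ofReal_ne_zero.2 hν.ne'
  have ht' : (t : ℂ) ≠ 0 := Complex.ofReal_ne_zero.2 ht.ne'
  have h1 := (hasDerivAt_dampedHeat_time (a := ‖ξ‖) hν ht (z - y)).ofReal_comp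
  have h2 := (hasDerivAt_dampedHeat_time (a := ‖ξ‖) hν ht (z + y)).ofReal_comp
  have h3 := hasDerivAt_residualFactor_time hν (norm_pos_iff.2 hξ) ht (z + y)
  convert! ((h1.add h2).const_mul ((1 : Matrix (Fin 2) (Fin 2) ℂ) i j)).add
    (h3.const_mul (perpMatrix ξ i j)) using 1
  rw [iteratedDeriv_two_greenFormula hν hξ ht, greenFormula]
  push_cast
  field_simp
  ring

/-- At `z = 0` the slopes of the heat kernel and of its mirror image cancel, so `G = 2h I + R P` and
`∂_z G = (-aR - (2/a) h) P`. Then `∂_z G + a⁻¹ P G = 0` by `P² = a² P`; the proof checks this entry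
by entry. -/
lemma greenFormula_boundary (hν : 0 < ν) (hξ : ξ ≠ 0) (ht : 0 < t) (y : ℝ) (i j : Fin 2) :
    -(ν : ℂ) * (deriv (fun z => greenFormula ν ξ t y z i j) 0
        + (‖ξ‖ : ℂ) * greenFormula ν ξ t y 0 i j)
      + (ν : ℂ) * ((ξ i : ℂ) * (‖ξ‖ : ℂ)⁻¹ * ∑ k, (ξ k : ℂ) * greenFormula ν ξ t y 0 k j) = 0 := by
  have hξ' : (‖ξ‖ : ℂ) ≠ 0 := Complex.ofReal_ne_zero.2 (norm_ne_zero_iff.2 hξ)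
  have hs := sum_sq_eq_norm_sq ξ
  rw [(hasDerivAt_greenFormula hν hξ ht y 0 i j).deriv]
  simp only [greenFormula, zero_sub, zero_add, dampedHeat_neg, Fin.sum_univ_two,
    Complex.ofReal_zero]
  set h : ℂ := (dampedHeat ν ‖ξ‖ t y : ℂ)
  set R := residualFactor ν ‖ξ‖ t y
  revert i j
  simp only [Fin.forall_fin_two, perpMatrix, Matrix.of_apply, Matrix.cons_val', Matrix.cons_val_zero,
    Matrix.cons_val_one, Matrix.one_apply, Fin.isValue]
  simp
  refine ⟨⟨?_, ?_⟩, ?_, ?_⟩ <;> field_simp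
  · linear_combination (4 * ν * h) * hs
  · ring
  · ring
  · linear_combination (4 * ν * h) * hs

end Regularity

/-! ### The initial value -/

section InitialValue

variable {ν : ℝ}

/-- The substitution `z = x + √(4νt) w` makes the Gaussian weight independent of `t`, ready for
dominated convergence. -/
lemma integral_dampedHeat_mul (hν : 0 < ν) {t : ℝ} (ht : 0 < t) (a x : ℝ) (f : ℝ → ℂ) :
    ∫ z, (dampedHeat ν a t (z - x) : ℂ) * f z =
      ((Real.sqrt Real.pi)⁻¹ * Real.exp (-ν * a ^ 2 * t) : ℝ) *
        ∫ w : ℝ, (Real.exp (-w ^ 2) : ℂ) * f (x + Real.sqrt (4 * ν * t) * w) := by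
  have hpos : 0 < 4 * ν * t := by positivity
  set q := Real.sqrt (4 * ν * t) with hq
  have hq0 : 0 < q := Real.sqrt_pos.2 hpos
  have hq2 : q ^ 2 = 4 * ν * t := Real.sq_sqrt hpos.le
  have h1 : ∫ z, (dampedHeat ν a t (z - x) : ℂ) * f z =
      ∫ z, (dampedHeat ν a t z : ℂ) * f (x + z) := by
    rw [← integral_add_left_eq_self _ x]
    simp
  have h2 := Measure.integral_comp_mul_left
    (fun z => (dampedHeat ν a t z : ℂ) * f (x + z)) q
  rw [abs_of_pos (inv_pos.2 hq0), Complex.real_smul] at h2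
  have h3 : ∫ z, (dampedHeat ν a t z : ℂ) * f (x + z) =
      q * ∫ w, (dampedHeat ν a t (q * w) : ℂ) * f (x + q * w) := by
    rw [h2, ← mul_assoc, ← Complex.ofReal_mul, mul_inv_cancel₀ hq0.ne', Complex.ofReal_one, one_mul]
  rw [h1, h3, ← integral_const_mul, ← integral_const_mul]
  congr 1
  funext w
  have h4 : q * dampedHeat ν a t (q * w) =
      (Real.sqrt Real.pi)⁻¹ * Real.exp (-ν * a ^ 2 * t) * Real.exp (-w ^ 2) := by
    have h5 : -(q * w) ^ 2 / (4 * ν * t) = -w ^ 2 := by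
      rw [mul_pow, hq2]
      field_simp
    have h6 : Real.sqrt (4 * Real.pi * ν * t) = Real.sqrt Real.pi * q := by
      rw [hq, ← Real.sqrt_mul Real.pi_pos.le]
      congr 1
      ring
    rw [dampedHeat, h5, h6]
    have := (Real.sqrt_pos.2 Real.pi_pos).ne'
    field_simp
  rw [← mul_assoc, ← mul_assoc, ← Complex.ofReal_mul, h4]
  push_cast
  ring

lemma tendsto_integral_dampedHeat_mul (hν : 0 < ν) (a x : ℝ) {f : ℝ → ℂ} (hf : Continuous f)
    (hfc : HasCompactSupport f) :
    Tendsto (fun t => ∫ z, (dampedHeat ν a t (z - x) : ℂ) * f z) (𝓝[>] 0) (𝓝 (f x)) := by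
  obtain ⟨C, hC⟩ := hfc.exists_bound_of_continuous hf
  have hdct : Tendsto (fun t : ℝ => ∫ w : ℝ, (Real.exp (-w ^ 2) : ℂ) *
      f (x + Real.sqrt (4 * ν * t) * w)) (𝓝[>] 0)
      (𝓝 (∫ w : ℝ, (Real.exp (-w ^ 2) : ℂ) * f x)) := by
    refine tendsto_integral_filter_of_dominated_convergence (fun w => Real.exp (-1 * w ^ 2) * C)
      (.of_forall fun t => ?_) (.of_forall fun t => .of_forall fun w => ?_)
      ((integrable_exp_neg_mul_sq one_pos).mul_const C) (.of_forall fun w => ?_)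
    · exact Continuous.aestronglyMeasurable (by fun_prop)
    · rw [norm_mul, Complex.norm_real, Real.norm_of_nonneg (Real.exp_pos _).le, neg_one_mul]
      gcongr
      exact hC _
    · have : Continuous fun t : ℝ => (Real.exp (-w ^ 2) : ℂ) *
          f (x + Real.sqrt (4 * ν * t) * w) := by fun_prop
      have h0 := (this.tendsto 0).mono_left (nhdsWithin_le_nhds (s := Ioi 0))
      simpa using h0
  have hconst : Tendsto (fun t : ℝ =>
      (((Real.sqrt Real.pi)⁻¹ * Real.exp (-ν * a ^ 2 * t) : ℝ) : ℂ)) (𝓝[>] 0)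
      (𝓝 (((Real.sqrt Real.pi)⁻¹ : ℝ) : ℂ)) := by
    have : Continuous fun t : ℝ =>
      (((Real.sqrt Real.pi)⁻¹ * Real.exp (-ν * a ^ 2 * t) : ℝ) : ℂ) := by fun_prop
    have h0 := (this.tendsto 0).mono_left (nhdsWithin_le_nhds (s := Ioi 0))
    simpa using h0
  have hval : (((Real.sqrt Real.pi)⁻¹ : ℝ) : ℂ) * ∫ w : ℝ, (Real.exp (-w ^ 2) : ℂ) * f x = f x := by
    have hg := integral_gaussian 1
    simp only [neg_one_mul, div_one] at hg
    rw [integral_mul_const, integral_complex_ofReal, hg, ← mul_assoc, ← Complex.ofReal_mul,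
      inv_mul_cancel₀ (Real.sqrt_pos.2 Real.pi_pos).ne', Complex.ofReal_one, one_mul]
  have := hconst.mul hdct
  rw [hval] at this
  refine this.congr' ?_
  filter_upwards [self_mem_nhdsWithin] with t ht
  exact (integral_dampedHeat_mul hν ht a x f).symm

/-- The argument `z + y` stays above `y > 0`, where the residual factor is `O(√t)` uniformly. -/
lemma tendsto_integral_residualFactor_mul (hν : 0 < ν) {a y : ℝ} (ha : 0 < a) (hy : 0 < y)
    {f : ℝ → ℂ} (hf : Integrable f) :
    Tendsto (fun t => ∫ z in Ioi (0 : ℝ), residualFactor ν a t (z + y) * f z)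
      (𝓝[>] 0) (𝓝 0) := by
  have hlim : Tendsto (fun t => (Real.pi * a)⁻¹ * (Real.exp (a * y) * (2 / y) *
      (Real.sqrt Real.pi * Real.sqrt (ν * t))) * ∫ z in Ioi (0 : ℝ), ‖f z‖) (𝓝[>] 0) (𝓝 0) := by
    have : Continuous fun t => (Real.pi * a)⁻¹ * (Real.exp (a * y) * (2 / y) *
      (Real.sqrt Real.pi * Real.sqrt (ν * t))) * ∫ z in Ioi (0 : ℝ), ‖f z‖ := by fun_prop
    have h0 := (this.tendsto 0).mono_left (nhdsWithin_le_nhds (s := Ioi 0))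
    simpa using h0
  refine squeeze_zero_norm' ?_ hlim
  filter_upwards [self_mem_nhdsWithin] with t ht
  rw [← integral_const_mul]
  refine norm_integral_le_of_norm_le (hf.norm.const_mul _).integrableOn
    ((ae_restrict_iff' measurableSet_Ioi).2 (.of_forall fun z hz => ?_))
  rw [norm_mul]
  gcongr
  have hz0 : (0 : ℝ) < z := hz
  exact norm_residualFactor_le hν ha ht hy (by linarith)

lemma tendsto_integral_greenFormula (hν : 0 < ν) {ξ : EuclideanSpace ℝ (Fin 2)} (hξ : ξ ≠ 0)
    {y : ℝ} (hy : 0 < y) {f : ℝ → Fin 2 → ℂ} (hf : Continuous f) (hfc : HasCompactSupport f)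
    (hfs : tsupport f ⊆ Ioi 0) :
    Tendsto (fun t : ℝ => ∫ z in Ioi (0 : ℝ), Matrix.of (greenFormula ν ξ t y z) *ᵥ f z)
      (𝓝[>] 0) (𝓝 (f y)) := by
  have ha := norm_pos_iff.2 hξ
  have hfj : ∀ j, Continuous fun z => f z j := fun j => (continuous_apply j).comp hf
  have hfcj : ∀ j, HasCompactSupport fun z => f z j := fun j =>
    hfc.comp_left (g := fun v : Fin 2 → ℂ => v j) rfl
  have hf0 : ∀ z, z ∉ Ioi (0 : ℝ) → f z = 0 := fun z hz =>
    image_eq_zero_of_notMem_tsupport fun h => hz (hfs h)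
  have hgc : ∀ {t : ℝ}, 0 < t → ∀ i j, Continuous fun z => greenFormula ν ξ t y z i j :=
    fun ht i j => (contDiff_greenFormula hν hξ ht y i j).continuous
  have hint : ∀ {t : ℝ}, 0 < t → ∀ i j, Integrable fun z => greenFormula ν ξ t y z i j * f z j :=
    fun ht i j => ((hgc ht i j).mul (hfj j)).integrable_of_hasCompactSupport
      (hfcj j).mul_left
  rw [tendsto_pi_nhds]
  intro i
  set q : ℝ → ℂ := fun z => (perpMatrix ξ *ᵥ f z) i with hq
  have hqj : q = fun z => perpMatrix ξ i 0 * f z 0 + perpMatrix ξ i 1 * f z 1 := by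
    funext z
    simp only [hq, Matrix.mulVec, dotProduct, Fin.sum_univ_two]
  have hqi : Integrable q := by
    rw [hqj]
    exact (((hfj 0).integrable_of_hasCompactSupport (hfcj 0)).const_mul _).add
      (((hfj 1).integrable_of_hasCompactSupport (hfcj 1)).const_mul _)
  have h1 := tendsto_integral_dampedHeat_mul hν ‖ξ‖ y (hfj i) (hfcj i)
  have h2 := tendsto_integral_dampedHeat_mul hν ‖ξ‖ (-y) (hfj i) (hfcj i)
  have h3 := tendsto_integral_residualFactor_mul hν ha hy hqi
  -- The mirror heat kernel concentrates at `-y`, outside the support of `f`.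
  have hny : f (-y) i = 0 := by
    rw [hf0 (-y) (by simpa using hy.le)]; rfl
  rw [hny] at h2
  have h4 := (h1.add h2).add h3
  rw [add_zero, add_zero] at h4
  refine h4.congr' ?_
  filter_upwards [self_mem_nhdsWithin] with t ht
  have ht0 : (0 : ℝ) < t := ht
  have hDc : Continuous fun r => (dampedHeat ν ‖ξ‖ t r : ℂ) :=
    Complex.continuous_ofReal.comp (contDiff_dampedHeat ν ‖ξ‖ t (n := 0)).continuous
  have hD : ∀ x, Integrable fun z => (dampedHeat ν ‖ξ‖ t (z - x) : ℂ) * f z i := fun x =>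
    ((hDc.comp (continuous_id.sub continuous_const)).mul (hfj i)).integrable_of_hasCompactSupport
      (hfcj i).mul_left
  have hDset : ∀ x, ∫ z in Ioi (0 : ℝ), (dampedHeat ν ‖ξ‖ t (z - x) : ℂ) * f z i =
      ∫ z, (dampedHeat ν ‖ξ‖ t (z - x) : ℂ) * f z i := fun x =>
    setIntegral_eq_integral_of_forall_compl_eq_zero fun z hz => by simp [hf0 z hz]
  have hRc : Continuous fun z => residualFactor ν ‖ξ‖ t (z + y) :=
    (contDiff_residualFactor hν ha ht0 0).continuous.comp (continuous_id.add continuous_const)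
  have hR : Integrable fun z => residualFactor ν ‖ξ‖ t (z + y) * q z := by
    refine (hRc.mul ?_).integrable_of_hasCompactSupport ?_
    · rw [hqj]
      exact (continuous_const.mul (hfj 0)).add (continuous_const.mul (hfj 1))
    · refine HasCompactSupport.mul_left ?_
      rw [hqj]
      exact (hfcj 0).mul_left.add (hfcj 1).mul_left
  have hDD : Integrable fun z => (dampedHeat ν ‖ξ‖ t (z - y) : ℂ) * f z i +
      (dampedHeat ν ‖ξ‖ t (z - -y) : ℂ) * f z i := (hD y).add (hD (-y))
  rw [eval_integral]
  · rw [← hDset, ← hDset, ← integral_add (hD _).integrableOn (hD _).integrableOn,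
      ← integral_add hDD.integrableOn hR.integrableOn]
    congr 1
    funext z
    have hone := congrFun (Matrix.one_mulVec (f z)) i
    simp only [Matrix.mulVec, dotProduct, Fin.sum_univ_two] at hone
    simp only [hqj, Matrix.mulVec, dotProduct, Fin.sum_univ_two, Matrix.of_apply, greenFormula,
      sub_neg_eq_add]
    linear_combination -((dampedHeat ν ‖ξ‖ t (z - y) : ℂ) + dampedHeat ν ‖ξ‖ t (z + y)) * hone
  · intro k
    simp only [Matrix.mulVec, dotProduct, Fin.sum_univ_two, Matrix.of_apply]
    exact ((hint ht0 k 0).add (hint ht0 k 1)).integrableOn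

end InitialValue

end

theorem theorem4p1 (ν : ℝ) (hν : 0 < ν) (ξ : EuclideanSpace ℝ (Fin 2)) (hξ : ξ ≠ 0) :
    -- the resolvent kernel is well defined off `(-∞, -ν|ξ|²] ∪ {0}`
    (∀ lam : ℂ, lam ≠ 0 → lam + (‖ξ‖ : ℂ) ^ 2 * (ν : ℂ) ∈ Complex.slitPlane →
      ∀ y : ℝ, 0 ≤ y →
        IsResolventOfDelta ν ξ lam y (resolventKernel ν ξ lam y) ∧
        ∀ K, IsResolventOfDelta ν ξ lam y K → EqOn K (resolventKernel ν ξ lam y) (Ici 0)) ∧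
    ∀ γ : ℝ → ℂ, IsAdmissiblePath γ →
      -- convergence of the contour integrals, and the decomposition
      (∀ t y z : ℝ, 0 < t → 0 ≤ y → 0 ≤ z →
        (∀ i j, PathIntegrable γ (fun lam => greenIntegrand ν ξ t y z lam i j)) ∧
        (∀ i j, PathIntegrable γ (fun lam => residualIntegrand ν ξ t y z lam i j)) ∧
        greenKernel ν ξ γ t y z = neumannHeatKernel ν ξ t y z + residualKernel ν ξ γ t y z) ∧
      ∀ y : ℝ, 0 < y →
        -- `G` is `C²` in `z` up to the boundary
        (∀ t : ℝ, 0 < t → ∀ i j,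
          ContDiffOn ℝ 2 (fun z => greenKernel ν ξ γ t y z i j) (Ici 0)) ∧
        -- heat equation
        (∀ t z : ℝ, 0 < t → 0 < z → ∀ i j,
          DifferentiableAt ℝ (fun τ => greenKernel ν ξ γ τ y z i j) t ∧
          deriv (fun τ => greenKernel ν ξ γ τ y z i j) t
            - (ν : ℂ) * (iteratedDeriv 2 (fun w => greenKernel ν ξ γ t y w i j) z
                - (‖ξ‖ : ℂ) ^ 2 * greenKernel ν ξ γ t y z i j) = 0) ∧
        -- boundary condition at `z = 0`
        (∀ t : ℝ, 0 < t → ∀ i j,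
          -(ν : ℂ) * (derivWithin (fun z => greenKernel ν ξ γ t y z i j) (Ici 0) 0
                + (‖ξ‖ : ℂ) * greenKernel ν ξ γ t y 0 i j)
            + (ν : ℂ) * ((ξ i : ℂ) * (‖ξ‖ : ℂ)⁻¹ *
                ∑ k, (ξ k : ℂ) * greenKernel ν ξ γ t y 0 k j) = 0) ∧
        -- initial value `δ_y I₂` in the sense of distributions on `(0, ∞)`
        (∀ f : ℝ → Fin 2 → ℂ, ContDiff ℝ ∞ f → HasCompactSupport f → tsupport f ⊆ Ioi 0 →
          Tendsto (fun t : ℝ => ∫ z in Ioi (0 : ℝ), greenKernel ν ξ γ t y z *ᵥ f z)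
            (𝓝[>] 0) (𝓝 (f y))) := by
  refine ⟨fun lam hlam h y hy => ?_, fun γ hγ => ⟨fun t y z ht hy hz =>
    ⟨hγ.pathIntegrable_greenIntegrand hν hξ ht hy hz,
      hγ.pathIntegrable_residualIntegrand hν hξ ht hy hz,
      hγ.greenKernel_decomposition hν hξ ht hy hz⟩, fun y hy => ?_⟩⟩
  · have hK := isResolventOfDelta_resolventKernel hν hξ hlam h hy
    exact ⟨hK, fun K hK' => hK'.eqOn hν hξ hlam h hK⟩
  have hG : ∀ {t z : ℝ}, 0 < t → 0 ≤ z → ∀ i j,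
      greenKernel ν ξ γ t y z i j = greenFormula ν ξ t y z i j :=
    fun ht hz => hγ.greenKernel_apply hν hξ ht hy.le hz
  refine ⟨fun t ht i j => ?_, fun t z ht hz i j => ?_, fun t ht i j => ?_, fun f hf hfc hfs => ?_⟩
  · exact (contDiff_greenFormula hν hξ ht y i j).contDiffOn.congr fun z hz => hG ht hz i j
  -- The kernel agrees with the formula only for `t > 0` and `z ≥ 0`; derivatives at interior points
  -- see just the germs.
  · have hz' : (fun w => greenKernel ν ξ γ t y w i j) =ᶠ[𝓝 z]
        fun w => greenFormula ν ξ t y w i j := by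
      filter_upwards [Ioi_mem_nhds hz] with w hw using hG ht hw.le i j
    have ht' : (fun τ => greenKernel ν ξ γ τ y z i j) =ᶠ[𝓝 t]
        fun τ => greenFormula ν ξ τ y z i j := by
      filter_upwards [Ioi_mem_nhds ht] with τ hτ using hG hτ hz.le i j
    have hd := (hasDerivAt_greenFormula_time hν hξ ht y z i j).congr_of_eventuallyEq ht'
    refine ⟨hd.differentiableAt, ?_⟩
    rw [hd.deriv, hz'.iteratedDeriv_eq 2, hG ht hz.le, sub_self]
  · have hu : UniqueDiffWithinAt ℝ (Ici (0 : ℝ)) 0 := uniqueDiffOn_Ici _ _ self_mem_Ici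
    have hd := (hasDerivAt_greenFormula hν hξ ht y 0 i j).differentiableAt.hasDerivAt
    have he : EqOn (fun z => greenKernel ν ξ γ t y z i j) (fun z => greenFormula ν ξ t y z i j)
        (Ici 0) := fun z hz => hG ht hz i j
    have hw : derivWithin (fun z => greenKernel ν ξ γ t y z i j) (Ici 0) 0 =
        deriv (fun z => greenFormula ν ξ t y z i j) 0 :=
      (derivWithin_congr he (he self_mem_Ici)).trans (hd.hasDerivWithinAt.derivWithin hu)
    rw [hw]
    simp only [hG ht le_rfl]
    exact greenFormula_boundary hν hξ ht y i j
  · refine (tendsto_integral_greenFormula hν hξ hy hf.continuous hfc hfs).congr' ?_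
    filter_upwards [self_mem_nhdsWithin] with t ht
    refine setIntegral_congr_fun measurableSet_Ioi fun z hz => ?_
    have : Matrix.of (greenFormula ν ξ t y z) = greenKernel ν ξ γ t y z := by
      ext i j
      exact (hG ht (le_of_lt hz) i j).symm
    simp only [this]
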